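/- A \emph{tree space} is a 1-dimensional Hausdorff space with the topology of a finite tree with at least one edge: its nodes are points, its edges are simple curves joining pairs of nodes and otherwise disjoint, and (without loss of generality) every node has degree $1$ or degree at least $3$; the nodes of degree $1$ are its \emph{leaves}. A \emph{tree} in a tree space is a nonempty connected subset of it. A leaf of a closed tree $T$ is a point of $T$ whose removal does not disconnect $T$ (so a single point has one leaf); the leaves of a tree that is not closed are those of its closure. For a finite set $\mathcal{A}$ of trees and a point $p$ let $S_p=\{T\in\mathcal{A} : p\in T\}$. A coloring of $\mathcal{A}$ is \emph{non-monochromatic} if, for every point $p$ with $|S_p|\ge 2$, the trees in $S_p$ do not all have the same color. It is \emph{conflict-free} if, for every point $p$ with $S_p\neq\emptyset$, some tree in $S_p$ has a color different from the colors of all other trees in $S_p$. \textbf{Theorem.} There is an absolute constant $C$ such that, for all natural numbers $k,\ell,n$, every tree space with at most $k$ leaves, and every set $\mathcal{A}$ of $n$ trees in it, each with at most $\ell$ leaves: \begin{enumerate} \item $\mathcal{A}$ has a non-monochromatic coloring with at most $\min(\ell+1,\,2\sqrt{6k})$ colors; \item $\mathcal{A}$ has a conflict-free coloring with at most $C\,\ell\log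 k$ colors. \end{enumerate} In particular, neither bound depends on $n$. -/

import Mathlib

/-- A tree space with underlying topological space `X` (always taken to be Hausdorff): finitely many
nodes, which are points of `X`, and for each edge of a finite tree a simple curve joining the two
end nodes of the edge; the curves are otherwise disjoint and together they make up `X`.
Every node has degree `1` or at least `3`. A tree embedded in the plane, with the subspace topology,
is an example; only the topology matters. -/
structure TreeSpace (X : Type*) [TopologicalSpace X] where
  /-- the index type of the nodes -/
  V : Type
  /-- there are finitely many nodes -/
  finite_V : Finite V
  /-- the combinatorial tree -/
  graph : SimpleGraph V
  isTree : graph.IsTree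
  degree_eq_one_or : ∀ v, (graph.neighborSet v).ncard = 1 ∨ 3 ≤ (graph.neighborSet v).ncard
  /-- the position of the nodes -/
  node : V → X
  node_injective : Function.Injective node
  /-- the curve of each edge -/
  arc : graph.edgeSet → unitInterval → X
  arc_continuous : ∀ e, Continuous (arc e)
  arc_injective : ∀ e, Function.Injective (arc e)
  /-- the two ends of the curve of an edge are the two end nodes of the edge -/
  arc_ends : ∀ e : graph.edgeSet, s(arc e 0, arc e 1) = Sym2.map node (e : Sym2 V)
  /-- a curve meets the nodes only in its two ends -/
  arc_eq_node : ∀ e t v, arc e t = node v → t = 0 ∨ t = 1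
  /-- two different curves meet only in nodes -/
  arc_disjoint : ∀ e f s t, e ≠ f → arc e s = arc f t → arc e s ∈ Set.range node
  /-- the curves cover the space -/
  arc_cover : ∀ x, ∃ e t, arc e t = x

/-- The number of leaves of a tree space: the number of its nodes of degree one. -/
noncomputable def TreeSpace.numLeaves {X : Type*} [TopologicalSpace X] (𝒯 : TreeSpace X) : ℕ :=
  {v : 𝒯.V | (𝒯.graph.neighborSet v).ncard = 1}.ncard

/-- The leaves of a connected subset `T` of a tree space. If `T` is closed, these are the points
of `T` whose removal does not disconnect `T` (the points of degree one); a tree that consists of a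
single point has one leaf. If `T` is not closed, its leaves are those of its closure. -/
def treeLeaves {X : Type*} [TopologicalSpace X] (T : Set X) : Set X :=
  {x | x ∈ closure T ∧ IsPreconnected (closure T \ {x})}

/-- `𝒜` is a set of `n` trees (connected subsets) with at most `ℓ` leaves each,
in a tree space with at most `k` leaves. -/
structure IsTreeFamily {X : Type*} [TopologicalSpace X] (𝒯 : TreeSpace X) (k ℓ n : ℕ)
    (𝒜 : Finset (Set X)) : Prop where
  numLeaves_le : 𝒯.numLeaves ≤ k
  card_eq : 𝒜.card = n
  isConnected : ∀ T ∈ 𝒜, IsConnected T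
  leaves_le : ∀ T ∈ 𝒜, (treeLeaves T).encard ≤ ℓ

/-- The objects of `𝒜` that contain the point `p`. -/
def objectsAt {X : Type*} (𝒜 : Finset (Set X)) (p : X) : Set {T // T ∈ 𝒜} :=
  {T | p ∈ T.1}

/-- Non-monochromatic coloring: at each point that lies in at least two objects, the objects that
contain it do not all have the same color. -/
def IsNMColoring {X κ : Type*} (𝒜 : Finset (Set X)) (c : {T // T ∈ 𝒜} → κ) : Prop :=
  ∀ p, (objectsAt 𝒜 p).Nontrivial → ∃ S ∈ objectsAt 𝒜 p, ∃ T ∈ objectsAt 𝒜 p, c S ≠ c T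

/-- Conflict-free coloring: at each point that lies in some object, one of the objects that contain
it has a color different from the colors of all other objects that contain it. -/
def IsCFColoring {X κ : Type*} (𝒜 : Finset (Set X)) (c : {T // T ∈ 𝒜} → κ) : Prop :=
  ∀ p, (objectsAt 𝒜 p).Nonempty →
    ∃ S ∈ objectsAt 𝒜 p, ∀ T ∈ objectsAt 𝒜 p, T ≠ S → c T ≠ c S

/-! Root the tree space at a node and let `x ≤ y` mean that `x` lies on the path from the root to
`y`. Each node owns a cell, the half-open arc leading to it, which is a chain. Counting degrees
gives |V| ≤ 2k - 2 cells. A connected set satisfies `IsSubtree`, and each of its points lies below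
one of its at most ℓ leaves; the colorings use nothing else about the trees. What drives them is
that down-sets (or up-sets) of a chain are nested, so the largest one hits whatever the others hit.

For ℓ + 1 colors, color last a tree T with maximal `outer T`, one that starts far from the root. The
other trees meet T in down-sets of T, and T is covered by the paths below its leaves. One tree per
path hits all that the others hit, so T need only avoid ℓ colors (`IsCellOrder.exists_nonMono`).

For 2√(6k) colors, a tree not inside one cell meets every cell in a down-set or an up-set. Three
pairs of trees per cell then suffice: if each pair is bichromatic, so is every point of depth at
least two. A graph with 3|V| edges is N-colorable once 6|V| < N(N + 1). Trees inside one cell are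
added afterwards, each avoiding two colors (`IsCellOrder.exists_nonMono_of_card`).

For conflict-free colorings, keep an irredundant subcover, where every tree has a private point. At
most 2|V| of its trees are not inside one cell; iterating the first bound colors them. Those inside
a cell have depth at most two, where non-monochromatic already means conflict-free. Discarded trees
share one extra color (`IsCellOrder.exists_conflictFree`). -/

/-- `F` is non-monochromatically colored by `c`: two different members with a common point never lie
at a point whose members all have the same color. -/
def NonMono {X κ : Type*} (F : Finset (Set X)) (c : Set X → κ) : Prop :=
  ∀ p, ∀ S ∈ F, ∀ T ∈ F, S ≠ T → p ∈ S → p ∈ T →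
    ∃ S' ∈ F, ∃ T' ∈ F, p ∈ S' ∧ p ∈ T' ∧ c S' ≠ c T'

/-- At every point covered by `F`, some member containing it has a unique color. -/
def ConflictFree {X κ : Type*} (F : Finset (Set X)) (c : Set X → κ) : Prop :=
  ∀ p, ∀ T ∈ F, p ∈ T → ∃ S ∈ F, p ∈ S ∧ ∀ S' ∈ F, p ∈ S' → S' ≠ S → c S' ≠ c S

/-! ### Colorings of set families: extending, merging, iterating -/

section Coloring

variable {X : Type*}

open scoped Classical in
-- `T` gets a color that does not occur on `D`. At covered points of `T` it differs from a member of
-- `D`; points outside `T` see no change.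
theorem NonMono.exists_insert {F : Finset (Set X)} {T : Set X} (hT : T ∉ F) {N : ℕ} {c : Set X → Fin N}
    (hc : NonMono F c) (D : Finset (Set X)) (hD : D ⊆ F) (hcard : D.card < N)
    (h : ∀ p ∈ T, ∀ S ∈ F, p ∈ S → ∃ S' ∈ D, p ∈ S') :
    ∃ c' : Set X → Fin N, NonMono (insert T F) c' := by
  obtain ⟨a, -, ha⟩ : ∃ a ∈ (Finset.univ : Finset (Fin N)), a ∉ D.image c :=
    Finset.exists_mem_notMem_of_card_lt_card
      (lt_of_le_of_lt Finset.card_image_le (by simpa using hcard))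
  have hne : ∀ S ∈ F, S ≠ T := fun S hS h => hT (h ▸ hS)
  refine ⟨Function.update c T a, fun p S hS S' hS' hSS' hpS hpS' => ?_⟩
  by_cases hp : p ∈ T
  · obtain ⟨R, hR, hpR⟩ : ∃ R ∈ F, p ∈ R := by
      rcases Finset.mem_insert.1 hS with rfl | hS
      · rcases Finset.mem_insert.1 hS' with rfl | hS'
        · exact absurd rfl hSS'
        · exact ⟨S', hS', hpS'⟩
      · exact ⟨S, hS, hpS⟩
    obtain ⟨Q, hQ, hpQ⟩ := h p hp R hR hpR
    refine ⟨T, Finset.mem_insert_self _ _, Q, Finset.mem_insert_of_mem (hD hQ), hp, hpQ, ?_⟩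
    rw [Function.update_self, Function.update_of_ne (hne Q (hD hQ))]
    exact fun h => ha (Finset.mem_image.2 ⟨Q, hQ, h.symm⟩)
  · have hmem : ∀ R ∈ insert T F, p ∈ R → R ∈ F := fun R hR hpR =>
      (Finset.mem_insert.1 hR).resolve_left fun h => hp (h ▸ hpR)
    obtain ⟨A, hA, B, hB, hpA, hpB, hAB⟩ := hc p S (hmem S hS hpS) S' (hmem S' hS' hpS') hSS' hpS hpS'
    refine ⟨A, Finset.mem_insert_of_mem hA, B, Finset.mem_insert_of_mem hB, hpA, hpB, ?_⟩
    rwa [Function.update_of_ne (hne A hA), Function.update_of_ne (hne B hB)]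

theorem exists_max_trace (G : Finset (Set X)) (hG : G.Nonempty) (K : Set X)
    (h : ∀ S ∈ G, ∀ S' ∈ G, S ∩ K ⊆ S' ∨ S' ∩ K ⊆ S) :
    ∃ I ∈ G, ∀ S ∈ G, S ∩ K ⊆ I := by
  obtain ⟨I, hI⟩ := Finset.exists_maximalFor (fun S : Set X => S ∩ K) G hG
  refine ⟨I, hI.1, fun S hS => (h S hS I hI.1).elim id fun h' => ?_⟩
  have := hI.2 hS (show I ∩ K ⊆ S ∩ K from fun x hx => ⟨h' hx, hx.2⟩)
  exact fun x hx => (this hx).1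

theorem exists_hitting (G : Finset (Set X)) (K : Set X)
    (h : ∀ S ∈ G, ∀ S' ∈ G, S ∩ K ⊆ S' ∨ S' ∩ K ⊆ S) :
    ∃ D ⊆ G, D.card ≤ 1 ∧ ∀ p ∈ K, ∀ S ∈ G, p ∈ S → ∃ S' ∈ D, p ∈ S' := by
  rcases G.eq_empty_or_nonempty with rfl | hG
  · exact ⟨∅, by simp, by simp, by simp⟩
  · obtain ⟨I, hI, hmax⟩ := exists_max_trace G hG K h
    exact ⟨{I}, by simpa using hI, by simp, fun p hp S hS hpS =>
      ⟨I, by simp, hmax S hS ⟨hpS, hp⟩⟩⟩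

open scoped Classical in
-- The pair has the largest and second largest traces on `K`: a point of `K` in two members lies in
-- both of these.
theorem exists_hitting_pair (G : Finset (Set X)) (K : Set X)
    (h : ∀ S ∈ G, ∀ S' ∈ G, S ∩ K ⊆ S' ∨ S' ∩ K ⊆ S) :
    ∃ P : Finset (Set X × Set X), P.card ≤ 1 ∧ (∀ q ∈ P, q.1 ∈ G ∧ q.2 ∈ G ∧ q.1 ≠ q.2) ∧
      ∀ p ∈ K, ∀ S ∈ G, ∀ S' ∈ G, S ≠ S' → p ∈ S → p ∈ S' → ∃ q ∈ P, p ∈ q.1 ∧ p ∈ q.2 := by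
  by_cases hG : G.Nontrivial
  · obtain ⟨I, hI, hmax⟩ := exists_max_trace G hG.nonempty K h
    obtain ⟨J, hJ, hmaxJ⟩ := exists_max_trace (G.erase I) (hG.erase_nonempty) K
      (fun S hS S' hS' => h S (Finset.mem_of_mem_erase hS) S' (Finset.mem_of_mem_erase hS'))
    refine ⟨{(I, J)}, by simp, ?_, fun p hp S hS S' hS' hne hpS hpS' => ⟨(I, J), by simp, ?_, ?_⟩⟩
    · simpa using ⟨hI, Finset.mem_of_mem_erase hJ, (Finset.ne_of_mem_erase hJ).symm⟩
    · exact hmax S hS ⟨hpS, hp⟩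
    · by_cases hSI : S = I
      · exact hmaxJ S' (Finset.mem_erase.2 ⟨fun h => hne (hSI.trans h.symm), hS'⟩) ⟨hpS', hp⟩
      · exact hmaxJ S (Finset.mem_erase.2 ⟨hSI, hS⟩) ⟨hpS, hp⟩
  · refine ⟨∅, by simp, by simp, fun p hp S hS S' hS' hne => (hG ⟨S, hS, S', hS', hne⟩).elim⟩

/-- Down-sets of a chain are nested. Taking `≥` for `r` gives the same for up-sets. -/
theorem trace_total_of_downward {K : Set X} {r : X → X → Prop}
    (hK : ∀ x ∈ K, ∀ y ∈ K, r x y ∨ r y x) {S S' : Set X}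
    (h : ∀ x ∈ K, ∀ y ∈ K, r x y → y ∈ S → x ∈ S)
    (h' : ∀ x ∈ K, ∀ y ∈ K, r x y → y ∈ S' → x ∈ S') :
    S ∩ K ⊆ S' ∨ S' ∩ K ⊆ S := by
  by_contra! hcon
  obtain ⟨⟨x, hx, hx'⟩, ⟨y, hy, hy'⟩⟩ := hcon.imp Set.not_subset.1 Set.not_subset.1
  rcases hK x hx.2 y hy.2 with hxy | hxy
  · exact hx' (h' x hx.2 y hy.2 hxy hy.1)
  · exact hy' (h y hy.2 x hx.2 hxy hx.1)

/-- There are `(m + 1) * m / 2` pairs of colors, so some two colors are joined by no pair of `P` and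
can be merged. -/
theorem exists_merged_coloring {α : Type*} (P : Finset (α × α)) {m : ℕ}
    (hm : 2 * P.card < (m + 1) * m)
    (c : α → Fin (m + 1)) (hc : ∀ q ∈ P, c q.1 ≠ c q.2) :
    ∃ c' : α → Fin m, ∀ q ∈ P, c' q.1 ≠ c' q.2 := by
  classical
  obtain ⟨s, hs, hsP⟩ : ∃ s ∈ (Finset.univ.filter fun s : Sym2 (Fin (m + 1)) => ¬ s.IsDiag),
      s ∉ P.image fun q => s(c q.1, c q.2) := by
    apply Finset.exists_mem_notMem_of_card_lt_card
    refine lt_of_le_of_lt Finset.card_image_le ?_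
    have := Sym2.card_subtype_not_diag (α := Fin (m + 1))
    rw [Fintype.card_subtype] at this
    rw [this, Fintype.card_fin, Nat.choose_two_right, Nat.add_sub_cancel]
    have := Nat.div_mul_cancel (Nat.even_mul_succ_self m).two_dvd
    rw [mul_comm m] at this
    omega
  induction s using Sym2.inductionOn with
  | _ i j =>
  have hij : i ≠ j := by simpa using hs
  let d : α → {x : Fin (m + 1) // x ≠ i} := fun x =>
    if h : c x = i then ⟨j, hij.symm⟩ else ⟨c x, h⟩
  refine ⟨fun x => (finSuccAboveEquiv i).symm (d x), fun q hq h => ?_⟩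
  have h1 : d q.1 = d q.2 := (Equiv.injective _) h
  have h2 := hc q hq
  have h3 : s(c q.1, c q.2) ≠ s(i, j) := fun h => hsP (Finset.mem_image.2 ⟨q, hq, h⟩)
  simp only [d] at h1
  split_ifs at h1 with h4 h5 h5
  · exact h2 (h4.trans h5.symm)
  · exact h3 (by rw [h4, ← (Subtype.mk.inj h1)])
  · exact h3 (by rw [h5, (Subtype.mk.inj h1), Sym2.eq_swap])
  · exact h2 (Subtype.mk.inj h1)

/-- A graph with fewer than `N (N + 1) / 2` edges is `N`-colorable. -/
theorem exists_coloring_of_card_lt {α : Type*} (P : Finset (α × α)) (hP : ∀ q ∈ P, q.1 ≠ q.2)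
    {N : ℕ} (hN : 2 * P.card < N * (N + 1)) :
    ∃ c : α → Fin N, ∀ q ∈ P, c q.1 ≠ c q.2 := by
  classical
  -- Start from a coloring that is injective on the elements occurring in `P`, then merge down to
  -- `N` colors.
  obtain ⟨n, hn, c, hc⟩ : ∃ n, N ≤ n ∧ ∃ c : α → Fin n, ∀ q ∈ P, c q.1 ≠ c q.2 := by
    let F := P.image Prod.fst ∪ P.image Prod.snd
    have h1 : ∀ q ∈ P, q.1 ∈ F := fun q hq =>
      Finset.mem_union_left _ (Finset.mem_image_of_mem _ hq)
    have h2 : ∀ q ∈ P, q.2 ∈ F := fun q hq =>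
      Finset.mem_union_right _ (Finset.mem_image_of_mem _ hq)
    refine ⟨N + (F.card + 1), by omega, fun x => if h : x ∈ F then
      ⟨F.equivFin ⟨x, h⟩, by have := (F.equivFin ⟨x, h⟩).2; omega⟩ else ⟨0, by omega⟩,
      fun q hq h => ?_⟩
    dsimp only at h
    rw [dif_pos (h1 q hq), dif_pos (h2 q hq)] at h
    have := F.equivFin.injective (Fin.ext (Fin.mk.inj h))
    exact hP q hq (Subtype.mk.inj this)
  induction n, hn using Nat.le_induction with
  | base => exact ⟨c, hc⟩
  | succ n hn ih =>
    obtain ⟨c', hc'⟩ := exists_merged_coloring P (by nlinarith) c hc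
    exact ih c' hc'

open scoped Classical in
-- A member without a private point can be dropped without uncovering anything.
theorem exists_irredundant_subcover (F : Finset (Set X)) :
    ∃ G ⊆ F, (∀ T ∈ F, ∀ p ∈ T, ∃ S ∈ G, p ∈ S) ∧
      ∀ T ∈ G, ∃ x ∈ T, ∀ S ∈ G, x ∈ S → S = T := by
  induction F using Finset.strongInduction with
  | H F ih =>
  by_cases h : ∀ T ∈ F, ∃ x ∈ T, ∀ S ∈ F, x ∈ S → S = T
  · exact ⟨F, subset_rfl, fun T hT p hp => ⟨T, hT, hp⟩, h⟩
  · push Not at h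
    obtain ⟨T, hT, h⟩ := h
    obtain ⟨G, hG, hcov, hpriv⟩ := ih (F.erase T) (Finset.erase_ssubset hT)
    refine ⟨G, hG.trans (Finset.erase_subset _ _), fun S hS p hp => ?_, hpriv⟩
    by_cases hST : S = T
    · obtain ⟨R, hR, hpR, hRT⟩ := h p (hST ▸ hp)
      exact hcov R (Finset.mem_erase.2 ⟨hRT, hR⟩) p hpR
    · exact hcov S (Finset.mem_erase.2 ⟨hST, hS⟩) p hp

open scoped Classical in
-- Reserve one color for a class of at least average size and recurse on the rest. A point covered
-- only by that class sees a single color, hence lies in a single member. Each round multiplies the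
-- size by at most `1 - 1 / d`, so `d * log` of it drops by at least 1.
theorem exists_conflictFree_of_hereditary {d : ℕ} (F : Finset (Set X))
    (hF : F.Nonempty)
    (h : ∀ G ⊆ F, ∃ c : Set X → Fin d, NonMono G c) :
    ∃ (m : ℕ) (c : Set X → ℕ), (m : ℝ) ≤ 1 + d * Real.log F.card ∧ (∀ T ∈ F, c T < m) ∧
      ConflictFree F c := by
  induction F using Finset.strongInduction with
  | H F ih =>
  obtain ⟨c, hc⟩ := h F subset_rfl
  obtain ⟨T₀, hT₀⟩ := hF
  have hd : 0 < d := (Nat.zero_le _).trans_lt (c T₀).2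
  obtain ⟨a, -, ha⟩ := Finset.exists_le_card_fiber_of_nsmul_le_card_of_maps_to (s := F)
    (t := Finset.univ) (f := c) (b := (F.card : ℝ) / d) (fun _ _ => Finset.mem_univ _)
    ⟨c T₀, Finset.mem_univ _⟩ (by
      have : (d : ℝ) ≠ 0 := by positivity
      simp only [Finset.card_univ, Fintype.card_fin, nsmul_eq_mul]
      rw [mul_div_cancel₀ _ this])
  set D := F.filter fun x => c x = a with hD
  have hcardF : (0 : ℝ) < F.card := by exact_mod_cast Finset.card_pos.2 ⟨T₀, hT₀⟩
  have hdR : (0 : ℝ) < d := by exact_mod_cast hd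
  have hDne : D.Nonempty := by
    rw [← Finset.card_pos]
    have : (0 : ℝ) < D.card := lt_of_lt_of_le (by positivity) ha
    exact_mod_cast this
  have huniq : ∀ p, (∀ S ∈ F \ D, p ∉ S) → ∀ S ∈ F, ∀ S' ∈ F, p ∈ S → p ∈ S' → S = S' := by
    intro p hp S hS S' hS' hpS hpS'
    by_contra hne
    obtain ⟨A, hA, B, hB, hpA, hpB, hAB⟩ := hc p S hS S' hS' hne hpS hpS'
    have key : ∀ A ∈ F, p ∈ A → c A = a := fun A hA hpA => by
      by_contra hcA
      exact hp A (by simp [hD, hA, hcA]) hpA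
    exact hAB ((key A hA hpA).trans (key B hB hpB).symm)
  rcases (F \ D).eq_empty_or_nonempty with hE | hE
  · refine ⟨1, fun _ => 0, ?_, by simp, fun p T hT hp => ⟨T, hT, hp, fun S hS hpS hne => ?_⟩⟩
    · have : 0 ≤ Real.log F.card := Real.log_natCast_nonneg _
      push_cast
      nlinarith
    · exact (hne (huniq p (by simp [hE]) S hS T hT hpS hp)).elim
  · obtain ⟨m, c', hm, hlt, hcf⟩ := ih (F \ D) (Finset.sdiff_ssubset (Finset.filter_subset _ _) hDne)
      hE (fun G hG => h G (hG.trans Finset.sdiff_subset))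
    refine ⟨m + 1, fun T => if T ∈ D then m else c' T, ?_, fun T hT => ?_, fun p T hT hp => ?_⟩
    · have hE' : (0 : ℝ) < (F \ D).card := by exact_mod_cast hE.card_pos
      have h1 : ((F \ D).card : ℝ) ≤ F.card * (1 - 1 / d) := by
        rw [Finset.cast_card_sdiff (Finset.filter_subset _ _)]
        have : (F.card : ℝ) * (1 - 1 / d) = F.card - F.card / d := by ring
        linarith
      have h3 : (0 : ℝ) < 1 - 1 / d := by
        by_contra hcon
        nlinarith
      have h2 : Real.log (F \ D).card ≤ Real.log F.card - 1 / d := by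
        refine (Real.log_le_log hE' h1).trans ?_
        rw [Real.log_mul hcardF.ne' h3.ne']
        have := Real.log_le_sub_one_of_pos h3
        linarith
      have h4 : (d : ℝ) * Real.log (F \ D).card ≤ d * (Real.log F.card - 1 / d) := by gcongr
      have h5 : (d : ℝ) * (Real.log F.card - 1 / d) = d * Real.log F.card - 1 := by
        field_simp
      push_cast
      linarith
    · dsimp only
      split_ifs with hTD
      · omega
      · have := hlt T (by simp [hT, hTD])
        omega
    · by_cases hex : ∃ S ∈ F \ D, p ∈ S
      · obtain ⟨S, hS, hpS⟩ := hex
        obtain ⟨R, hR, hpR, hRu⟩ := hcf p S hS hpS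
        have hR' := Finset.mem_sdiff.1 hR
        refine ⟨R, hR'.1, hpR, fun Q hQ hpQ hne => ?_⟩
        dsimp only
        rw [if_neg hR'.2]
        split_ifs with hQD
        · exact (hlt R hR).ne'
        · exact hRu Q (by simp [hQ, hQD]) hpQ hne
      · push Not at hex
        exact ⟨T, hT, hp, fun S hS hpS hne => (hne (huniq p hex S hS T hT hpS hp)).elim⟩

end Coloring

/-! ### Subtrees in a cell order and their colorings -/

/-- A forest order whose points are partitioned into chains, the fibers of `cell`, such that a cell
lies entirely below every point outside it that is above one of its points. -/
structure IsCellOrder {X V : Type*} [PartialOrder X] (cell : X → V) : Prop where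
  total_below : ∀ {x y z : X}, x ≤ z → y ≤ z → x ≤ y ∨ y ≤ x
  total_cell : ∀ {x y : X}, cell x = cell y → x ≤ y ∨ y ≤ x
  le_of_cell_ne : ∀ {x y z : X}, x ≤ y → cell y ≠ cell x → cell z = cell x → z ≤ y

/-- A set that contains every point `z ≤ y ∈ T` separating `y` from a point of `T`. -/
def IsSubtree {X : Type*} [PartialOrder X] (T : Set X) : Prop :=
  ∀ x ∈ T, ∀ y ∈ T, ∀ z, z ≤ y → ¬ z ≤ x → z ∈ T

/-- The points below a member of `T` that are not in `T`. -/
def outer {X : Type*} [PartialOrder X] (T : Set X) : Set X :=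
  {x | x ∉ T ∧ ∃ p ∈ T, x ≤ p}

section CellOrder

variable {X V : Type*} [PartialOrder X] {cell : X → V}

theorem IsSubtree.convex {T : Set X} (hT : IsSubtree T) {x y z : X} (hx : x ∈ T) (hy : y ∈ T)
    (hxz : x ≤ z) (hzy : z ≤ y) : z ∈ T := by
  by_cases h : z ≤ x
  · rwa [le_antisymm h hxz]
  · exact hT x hx y hy z hzy h

/-- If `x ∉ S`, then `x` lies in `outer S` but not in `outer T`. Any point of `outer T` is below
`p`, hence comparable with `x`; convexity puts it below `x` and outside `S`. So `outer T ⊂ outer S`.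
-/
theorem IsCellOrder.mem_of_not_outer_ssubset (hX : IsCellOrder cell) {S T : Set X}
    (hS : IsSubtree S) (hT : IsSubtree T) (h : ¬ outer T ⊂ outer S) {p x : X}
    (hpS : p ∈ S) (hpT : p ∈ T) (hxT : x ∈ T) (hxp : x ≤ p) : x ∈ S := by
  by_contra hxS
  refine h ⟨fun y ⟨hyT, q, hq, hyq⟩ => ?_, fun hsub => (hsub ⟨hxS, p, hpS, hxp⟩).1 hxT⟩
  have hyp : y ≤ p := by
    by_contra hyp
    exact hyT (hT p hpT q hq y hyq hyp)
  refine ⟨fun hyS => ?_, p, hpS, hyp⟩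
  rcases hX.total_below hxp hyp with hxy | hyx
  · exact hyT (hT.convex hxT hpT hxy hyp)
  · exact hxS (hS.convex hyS hpS hyx hxp)

open scoped Classical in
theorem IsCellOrder.exists_nonMono (hX : IsCellOrder cell) {ℓ : ℕ} (F : Finset (Set X))
    (hF : ∀ T ∈ F, IsSubtree T)
    (hQ : ∀ T ∈ F, ∃ Q : Finset X, Q.card ≤ ℓ ∧ ∀ p ∈ T, ∃ q ∈ Q, p ≤ q) :
    ∃ c : Set X → Fin (ℓ + 1), NonMono F c := by
  induction F using Finset.strongInduction with
  | H F ih =>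
  rcases F.eq_empty_or_nonempty with rfl | hne
  · exact ⟨fun _ => 0, by simp [NonMono]⟩
  obtain ⟨T, hT, hmax⟩ := Finset.exists_maximalFor (outer (X := X)) F hne
  obtain ⟨c, hc⟩ := ih (F.erase T) (Finset.erase_ssubset hT)
    (fun S hS => hF S (Finset.mem_of_mem_erase hS)) (fun S hS => hQ S (Finset.mem_of_mem_erase hS))
  obtain ⟨Q, hQcard, hQT⟩ := hQ T hT
  have hdown : ∀ S ∈ F.erase T, ∀ x ∈ T, ∀ y ∈ T, x ≤ y → y ∈ S → x ∈ S := by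
    intro S hS x hx y hy hxy hyS
    have hSF := Finset.mem_of_mem_erase hS
    exact hX.mem_of_not_outer_ssubset (hF S hSF) (hF T hT)
      (fun h => h.2 (hmax hSF h.1)) hyS hy hx hxy
  -- Below a single `q` the set `T` is a chain, so one member hits all that the others hit there.
  have hhit : ∀ q : X, ∃ D ⊆ F.erase T, D.card ≤ 1 ∧
      ∀ p ∈ T ∩ Set.Iic q, ∀ S ∈ F.erase T, p ∈ S → ∃ S' ∈ D, p ∈ S' := fun q =>
    exists_hitting _ _ fun S hS S' hS' => trace_total_of_downward (r := (· ≤ ·))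
      (fun x hx y hy => hX.total_below hx.2 hy.2)
      (fun x hx y hy => hdown S hS x hx.1 y hy.1) (fun x hx y hy => hdown S' hS' x hx.1 y hy.1)
  choose D hDF hDcard hD using hhit
  have := hc.exists_insert (Finset.notMem_erase T F) (Q.biUnion D)
    (Finset.biUnion_subset.2 fun q _ => hDF q)
    (by have := Finset.card_biUnion_le_card_mul Q D 1 (fun q _ => hDcard q); omega)
    (fun p hp S hS hpS => by
      obtain ⟨q, hq, hpq⟩ := hQT p hp
      obtain ⟨S', hS', hpS'⟩ := hD q p ⟨hp, hpq⟩ S hS hpS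
      exact ⟨S', Finset.mem_biUnion.2 ⟨q, hq, hS'⟩, hpS'⟩)
  rwa [Finset.insert_erase hT] at this

/-- If the point of `S` outside the cell is above some point of the cell, it is above the whole cell
and convexity gives an up-set. Otherwise it is above no point of the cell, and `IsSubtree` gives a
down-set. -/
theorem IsCellOrder.trace_cell (hX : IsCellOrder cell) {S : Set X} (hS : IsSubtree S) {v : V}
    (hSv : ∃ x ∈ S, cell x ≠ v) :
    (∀ x ∈ cell ⁻¹' {v}, ∀ y ∈ cell ⁻¹' {v}, x ≤ y → y ∈ S → x ∈ S) ∨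
      (∀ x ∈ cell ⁻¹' {v}, ∀ y ∈ cell ⁻¹' {v}, x ≥ y → y ∈ S → x ∈ S) := by
  obtain ⟨a, ha, hav⟩ := hSv
  by_cases h : ∃ w, cell w = v ∧ w ≤ a
  · obtain ⟨w, rfl, hwa⟩ := h
    exact Or.inr fun x hx y hy hxy hyS => hS.convex hyS ha hxy (hX.le_of_cell_ne hwa hav hx)
  · push Not at h
    exact Or.inl fun x hx y hy hxy hyS => hS a ha y hyS x hxy (h x hx)

open scoped Classical in
/-- Sets within single cells can be added to a non-monochromatically colored family. -/
theorem IsCellOrder.exists_nonMono_union (hX : IsCellOrder cell) {N : ℕ} (hN : 3 ≤ N)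
    (B : Finset (Set X)) (hB : ∀ T ∈ B, IsSubtree T) (hB' : ∀ T ∈ B, ∀ v, ∃ x ∈ T, cell x ≠ v)
    (hc : ∃ c : Set X → Fin N, NonMono B c)
    (I : Finset (Set X)) (hI : ∀ T ∈ I, IsSubtree T) (hI' : ∀ T ∈ I, ∃ v, ∀ x ∈ T, cell x = v) :
    ∃ c : Set X → Fin N, NonMono (B ∪ I) c := by
  induction I using Finset.strongInduction with
  | H I ih =>
  rcases I.eq_empty_or_nonempty with rfl | hne
  · simpa using hc
  obtain ⟨T, hT, hmax⟩ := Finset.exists_maximalFor (outer (X := X)) I hne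
  obtain ⟨c', hc'⟩ := ih (I.erase T) (Finset.erase_ssubset hT)
    (fun S hS => hI S (Finset.mem_of_mem_erase hS)) (fun S hS => hI' S (Finset.mem_of_mem_erase hS))
  obtain ⟨v, hv⟩ := hI' T hT
  have hTB : T ∉ B := fun h => by
    obtain ⟨x, hx, hxv⟩ := hB' T h v
    exact hxv (hv x hx)
  have htot : ∀ x ∈ T, ∀ y ∈ T, x ≤ y ∨ y ≤ x := fun x hx y hy =>
    hX.total_cell ((hv x hx).trans (hv y hy).symm)
  set F := B ∪ I.erase T with hFdef
  -- Members of `I` meet `T` in down-sets by maximality, members of `B` in down-sets or up-sets. One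
  -- member of each kind hits everything, which leaves a third color for `T`.
  obtain ⟨D₁, hD₁, hcard₁, hhit₁⟩ := exists_hitting
    (F.filter fun S => ∀ x ∈ T, ∀ y ∈ T, x ≤ y → y ∈ S → x ∈ S) T
    (fun S hS S' hS' => trace_total_of_downward (r := (· ≤ ·)) htot
      (Finset.mem_filter.1 hS).2 (Finset.mem_filter.1 hS').2)
  obtain ⟨D₂, hD₂, hcard₂, hhit₂⟩ := exists_hitting
    (F.filter fun S => ∀ x ∈ T, ∀ y ∈ T, x ≥ y → y ∈ S → x ∈ S) T
    (fun S hS S' hS' => trace_total_of_downward (r := (· ≥ ·))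
      (fun x hx y hy => (htot x hx y hy).symm)
      (Finset.mem_filter.1 hS).2 (Finset.mem_filter.1 hS').2)
  have hTF : T ∉ F := by simp [hFdef, hTB]
  have := hc'.exists_insert hTF (D₁ ∪ D₂)
    (Finset.union_subset (hD₁.trans (Finset.filter_subset _ _))
      (hD₂.trans (Finset.filter_subset _ _)))
    (by have := Finset.card_union_le D₁ D₂; omega)
    (fun p hp S hS hpS => by
      have : (∀ x ∈ T, ∀ y ∈ T, x ≤ y → y ∈ S → x ∈ S) ∨
          ∀ x ∈ T, ∀ y ∈ T, x ≥ y → y ∈ S → x ∈ S := by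
        rcases Finset.mem_union.1 hS with hSB | hSI
        · exact (hX.trace_cell (hB S hSB) (hB' S hSB v)).imp
            (fun h x hx y hy => h x (hv x hx) y (hv y hy))
            (fun h x hx y hy => h x (hv x hx) y (hv y hy))
        · have hSI := Finset.mem_of_mem_erase hSI
          exact Or.inl fun x hx y hy hxy hyS => hX.mem_of_not_outer_ssubset (hI S hSI) (hI T hT)
            (fun h => h.2 (hmax hSI h.1)) hyS hy hx hxy
      rcases this with h | h
      · obtain ⟨S', hS', hpS'⟩ := hhit₁ p hp S (Finset.mem_filter.2 ⟨hS, h⟩) hpS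
        exact ⟨S', Finset.mem_union_left _ hS', hpS'⟩
      · obtain ⟨S', hS', hpS'⟩ := hhit₂ p hp S (Finset.mem_filter.2 ⟨hS, h⟩) hpS
        exact ⟨S', Finset.mem_union_right _ hS', hpS'⟩)
  rwa [hFdef, ← Finset.union_insert, Finset.insert_erase hT] at this

open scoped Classical in
/-- Within one cell, three pairs suffice to hit all points of depth at least two. -/
theorem IsCellOrder.exists_pairs_cell (hX : IsCellOrder cell)
    (B : Finset (Set X)) (hB : ∀ T ∈ B, IsSubtree T) (hB' : ∀ T ∈ B, ∀ v, ∃ x ∈ T, cell x ≠ v)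
    (v : V) :
    ∃ P : Finset (Set X × Set X), P.card ≤ 3 ∧ (∀ q ∈ P, q.1 ∈ B ∧ q.2 ∈ B ∧ q.1 ≠ q.2) ∧
      ∀ p ∈ cell ⁻¹' {v}, ∀ S ∈ B, ∀ S' ∈ B, S ≠ S' → p ∈ S → p ∈ S' →
        ∃ q ∈ P, p ∈ q.1 ∧ p ∈ q.2 := by
  set K := cell ⁻¹' {v} with hK
  have htot : ∀ x ∈ K, ∀ y ∈ K, x ≤ y ∨ y ≤ x := fun x hx y hy =>
    hX.total_cell ((show cell x = v from hx).trans (show cell y = v from hy).symm)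
  set 𝓛 := B.filter fun S => ∀ x ∈ K, ∀ y ∈ K, x ≤ y → y ∈ S → x ∈ S
  set 𝓤 := B.filter fun S => ∀ x ∈ K, ∀ y ∈ K, x ≥ y → y ∈ S → x ∈ S
  have hL : ∀ S ∈ 𝓛, ∀ S' ∈ 𝓛, S ∩ K ⊆ S' ∨ S' ∩ K ⊆ S := fun S hS S' hS' =>
    trace_total_of_downward (r := (· ≤ ·)) htot
      (Finset.mem_filter.1 hS).2 (Finset.mem_filter.1 hS').2
  have hU : ∀ S ∈ 𝓤, ∀ S' ∈ 𝓤, S ∩ K ⊆ S' ∨ S' ∩ K ⊆ S := fun S hS S' hS' =>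
    trace_total_of_downward (r := (· ≥ ·)) (fun x hx y hy => (htot x hx y hy).symm)
      (Finset.mem_filter.1 hS).2 (Finset.mem_filter.1 hS').2
  have hLU : ∀ S ∈ B, S ∈ 𝓛 ∨ S ∈ 𝓤 := fun S hS =>
    (hX.trace_cell (hB S hS) (hB' S hS v)).imp (fun h => Finset.mem_filter.2 ⟨hS, h⟩)
      (fun h => Finset.mem_filter.2 ⟨hS, h⟩)
  have hLB : ∀ S ∈ 𝓛, S ∈ B := fun S hS => (Finset.mem_filter.1 hS).1
  have hUB : ∀ S ∈ 𝓤, S ∈ B := fun S hS => (Finset.mem_filter.1 hS).1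
  obtain ⟨P₁, hc₁, hP₁, hh₁⟩ := exists_hitting_pair 𝓛 K hL
  obtain ⟨P₂, hc₂, hP₂, hh₂⟩ := exists_hitting_pair 𝓤 K hU
  obtain ⟨P₃, hc₃, hP₃, hh₃⟩ : ∃ P : Finset (Set X × Set X), P.card ≤ 1 ∧
      (∀ q ∈ P, q.1 ∈ B ∧ q.2 ∈ B ∧ q.1 ≠ q.2) ∧ ∀ p ∈ K, ∀ S ∈ 𝓛, ∀ S' ∈ 𝓤, S ≠ S' → p ∈ S →
        p ∈ S' → ∃ q ∈ P₁ ∪ P₂ ∪ P, p ∈ q.1 ∧ p ∈ q.2 := by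
    by_cases hne : 𝓛.Nonempty ∧ 𝓤.Nonempty
    · obtain ⟨I, hI, hImax⟩ := exists_max_trace 𝓛 hne.1 K hL
      obtain ⟨J, hJ, hJmax⟩ := exists_max_trace 𝓤 hne.2 K hU
      -- If one set is largest in both classes there is no mixed pair, but none is needed: one of
      -- `S`, `S'` differs from it and forms with it two members of a single class.
      by_cases hIJ : I = J
      · subst hIJ
        refine ⟨∅, by simp, by simp, fun p hp S hS S' hS' hSS' hpS hpS' => ?_⟩
        by_cases hSI : S = I
        · obtain ⟨q, hq, h⟩ := hh₂ p hp S' hS' I hJ (fun h => hSS' (hSI.trans h.symm)) hpS'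
            (hJmax S' hS' ⟨hpS', hp⟩)
          exact ⟨q, by simp [hq], h⟩
        · obtain ⟨q, hq, h⟩ := hh₁ p hp S hS I hI hSI hpS (hImax S hS ⟨hpS, hp⟩)
          exact ⟨q, by simp [hq], h⟩
      · exact ⟨{(I, J)}, by simp, by simpa using ⟨hLB I hI, hUB J hJ, hIJ⟩,
          fun p hp S hS S' hS' hSS' hpS hpS' =>
            ⟨(I, J), by simp, hImax S hS ⟨hpS, hp⟩, hJmax S' hS' ⟨hpS', hp⟩⟩⟩
    · exact ⟨∅, by simp, by simp, fun p hp S hS S' hS' => (hne ⟨⟨S, hS⟩, ⟨S', hS'⟩⟩).elim⟩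
  refine ⟨P₁ ∪ P₂ ∪ P₃, ?_, fun q hq => ?_, fun p hp S hS S' hS' hne hpS hpS' => ?_⟩
  · have h1 := Finset.card_union_le (P₁ ∪ P₂) P₃
    have h2 := Finset.card_union_le P₁ P₂
    omega
  · rcases Finset.mem_union.1 hq with hq | hq
    · rcases Finset.mem_union.1 hq with hq | hq
      · obtain ⟨h1, h2, h3⟩ := hP₁ q hq
        exact ⟨hLB _ h1, hLB _ h2, h3⟩
      · obtain ⟨h1, h2, h3⟩ := hP₂ q hq
        exact ⟨hUB _ h1, hUB _ h2, h3⟩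
    · exact hP₃ q hq
  · rcases hLU S hS with hSL | hSU <;> rcases hLU S' hS' with hSL' | hSU'
    · obtain ⟨q, hq, h⟩ := hh₁ p hp S hSL S' hSL' hne hpS hpS'
      exact ⟨q, by simp [hq], h⟩
    · exact hh₃ p hp S hSL S' hSU' hne hpS hpS'
    · exact hh₃ p hp S' hSL' S hSU hne.symm hpS' hpS
    · obtain ⟨q, hq, h⟩ := hh₂ p hp S hSU S' hSU' hne hpS hpS'
      exact ⟨q, by simp [hq], h⟩

open scoped Classical in
theorem IsCellOrder.exists_nonMono_of_card [Finite V] (hX : IsCellOrder cell)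
    (F : Finset (Set X)) (hF : ∀ T ∈ F, IsSubtree T) {N : ℕ} (hN : 3 ≤ N)
    (hNV : 2 * (3 * Nat.card V) < N * (N + 1)) :
    ∃ c : Set X → Fin N, NonMono F c := by
  have := Fintype.ofFinite V
  set B := F.filter fun T => ∀ v, ∃ x ∈ T, cell x ≠ v with hBdef
  have hB : ∀ T ∈ B, IsSubtree T := fun T hT => hF T (Finset.mem_filter.1 hT).1
  have hB' : ∀ T ∈ B, ∀ v, ∃ x ∈ T, cell x ≠ v := fun T hT => (Finset.mem_filter.1 hT).2
  choose P hPcard hPB hP using hX.exists_pairs_cell B hB hB'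
  obtain ⟨c, hc⟩ := exists_coloring_of_card_lt (Finset.univ.biUnion P)
    (fun q hq => by
      obtain ⟨v, -, hq⟩ := Finset.mem_biUnion.1 hq
      exact (hPB v q hq).2.2) (N := N)
    (lt_of_le_of_lt (by
      have := Finset.card_biUnion_le_card_mul Finset.univ P 3 (fun v _ => hPcard v)
      rw [Finset.card_univ, ← Nat.card_eq_fintype_card] at this
      omega) hNV)
  have hcB : NonMono B c := fun p S hS S' hS' hne hpS hpS' => by
    obtain ⟨q, hq, h⟩ := hP (cell p) p rfl S hS S' hS' hne hpS hpS'
    obtain ⟨h1, h2, -⟩ := hPB _ q hq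
    exact ⟨q.1, h1, q.2, h2, h.1, h.2, hc q (Finset.mem_biUnion.2 ⟨_, Finset.mem_univ _, hq⟩)⟩
  have hun := hX.exists_nonMono_union hN B hB hB' ⟨c, hcB⟩
    (F.filter fun T => ¬ ∀ v, ∃ x ∈ T, cell x ≠ v) (fun T hT => hF T (Finset.mem_filter.1 hT).1)
    (fun T hT => by
      have := (Finset.mem_filter.1 hT).2
      push Not at this
      exact this)
  rwa [hBdef, Finset.filter_union_filter_not_eq] at hun

open scoped Classical in
theorem IsCellOrder.exists_conflictFree [Finite V] (hX : IsCellOrder cell) {ℓ : ℕ}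
    (A : Finset (Set X)) (hA : ∀ T ∈ A, IsSubtree T)
    (hQ : ∀ T ∈ A, ∃ Q : Finset X, Q.card ≤ ℓ ∧ ∀ p ∈ T, ∃ q ∈ Q, p ≤ q) :
    ∃ (m : ℕ) (c : Set X → ℕ),
      (m : ℝ) ≤ (ℓ + 1) * Real.log (2 * Nat.card V : ℕ) + ℓ + 3 ∧ (∀ T ∈ A, c T < m) ∧
        ConflictFree A c := by
  have := Fintype.ofFinite V
  obtain ⟨G, hGA, hcov, hpriv⟩ := exists_irredundant_subcover A
  have hG : ∀ T ∈ G, IsSubtree T := fun T hT => hA T (hGA hT)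
  set B := G.filter fun T => ∀ v, ∃ x ∈ T, cell x ≠ v with hBdef
  have hBG : B ⊆ G := Finset.filter_subset _ _
  set I := G.filter fun T => ¬ ∀ v, ∃ x ∈ T, cell x ≠ v with hIdef
  have hIG : I ⊆ G := Finset.filter_subset _ _
  have hI : ∀ T ∈ I, ∀ x ∈ T, ∀ y ∈ T, cell x = cell y := by
    intro T hT x hx y hy
    have := (Finset.mem_filter.1 hT).2
    push Not at this
    obtain ⟨v, hv⟩ := this
    exact (hv x hx).trans (hv y hy).symm
  rcases isEmpty_or_nonempty X with hXe | hXne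
  · have : 0 ≤ Real.log (2 * Nat.card V : ℕ) := Real.log_natCast_nonneg _
    refine ⟨1, fun _ => 0, ?_, by simp, fun p => hXe.elim p⟩
    have : (0 : ℝ) ≤ (ℓ + 1) * Real.log (2 * Nat.card V : ℕ) := by positivity
    have : (0 : ℝ) ≤ ℓ := by positivity
    push_cast at *
    linarith
  choose! x hxT hxu using hpriv
  have hBcard : B.card ≤ 2 * Nat.card V := by
    -- The cell of the private point and the direction of the trace determine the tree: otherwise
    -- two nested traces would share a private point.
    let f : Set X → V × Prop := fun T => (cell (x T),
      ∀ a ∈ cell ⁻¹' {cell (x T)}, ∀ b ∈ cell ⁻¹' {cell (x T)}, a ≤ b → b ∈ T → a ∈ T)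
    have hf : Set.InjOn f B := by
      intro S hS T hT hST
      obtain ⟨h1, h2⟩ := Prod.mk.inj hST
      rw [← h1] at h2
      have hS' := hX.trace_cell (hG S (hBG hS)) ((Finset.mem_filter.1 hS).2 (cell (x S)))
      have hT' := hX.trace_cell (hG T (hBG hT)) ((Finset.mem_filter.1 hT).2 (cell (x S)))
      have key : S ∩ cell ⁻¹' {cell (x S)} ⊆ T ∨ T ∩ cell ⁻¹' {cell (x S)} ⊆ S := by
        by_cases h : ∀ a ∈ cell ⁻¹' {cell (x S)}, ∀ b ∈ cell ⁻¹' {cell (x S)}, a ≤ b → b ∈ S → a ∈ S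
        · exact trace_total_of_downward (r := (· ≤ ·)) (fun a ha b hb => hX.total_cell
            ((show cell a = _ from ha).trans (show cell b = _ from hb).symm)) h (h2 ▸ h)
        · exact trace_total_of_downward (r := (· ≥ ·)) (fun a ha b hb => hX.total_cell
            ((show cell b = _ from hb).trans (show cell a = _ from ha).symm))
            (hS'.resolve_left h) (hT'.resolve_left (h2 ▸ h))
      rcases key with h | h
      · exact (hxu S (hBG hS) T (hBG hT) (h ⟨hxT S (hBG hS), rfl⟩)).symm
      · exact hxu T (hBG hT) S (hBG hS) (h ⟨hxT T (hBG hT), h1.symm⟩)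
    have h := Finset.card_le_card_of_injOn f (t := Finset.univ) (fun _ _ => Finset.mem_coe.2 (Finset.mem_univ _)) hf
    rw [Finset.card_univ, Fintype.card_prod, Fintype.card_prop] at h
    rw [Nat.card_eq_fintype_card]
    omega
  obtain ⟨cI, hcI⟩ := hX.exists_nonMono (ℓ := ℓ) I (fun T hT => hG T (hIG hT))
    (fun T hT => hQ T (hGA (hIG hT)))
  obtain ⟨mB, cB, hmB, hcBlt, hcB⟩ : ∃ (m : ℕ) (c : Set X → ℕ),
      (m : ℝ) ≤ 1 + (ℓ + 1) * Real.log (2 * Nat.card V : ℕ) ∧ (∀ T ∈ B, c T < m) ∧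
        ConflictFree B c := by
    rcases B.eq_empty_or_nonempty with hB | hB
    · have : 0 ≤ Real.log (2 * Nat.card V : ℕ) := Real.log_natCast_nonneg _
      exact ⟨0, fun _ => 0, by push_cast at this ⊢; positivity, by simp [hB], by simp [ConflictFree, hB]⟩
    · obtain ⟨m, c, hm, hlt, hc⟩ := exists_conflictFree_of_hereditary (d := ℓ + 1) B hB
        (fun F hF => hX.exists_nonMono F (fun T hT => hG T (hBG (hF hT)))
          (fun T hT => hQ T (hGA (hBG (hF hT)))))
      refine ⟨m, c, hm.trans ?_, hlt, hc⟩
      have : (0 : ℝ) < B.card := by exact_mod_cast hB.card_pos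
      push_cast only [Nat.cast_add, Nat.cast_one]
      gcongr
  -- Of three trees through `p`, two have their private points on the same side of `p`; by convexity
  -- the one whose private point is farther contains the other private point.
  have hdepth : ∀ p, ∀ T₁ ∈ I, ∀ T₂ ∈ I, ∀ T₃ ∈ I, p ∈ T₁ → p ∈ T₂ → p ∈ T₃ →
      T₁ ≠ T₂ → T₁ ≠ T₃ → T₂ ≠ T₃ → False := by
    intro p T₁ h₁ T₂ h₂ T₃ h₃ hp₁ hp₂ hp₃ h12 h13 h23
    have hlow : ∀ S ∈ I, ∀ T ∈ I, p ∈ S → p ∈ T → S ≠ T → x S ≤ p → x T ≤ p → False := by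
      intro S hS T hT hpS hpT hne hxS hxT'
      rcases hX.total_below hxS hxT' with h | h
      · exact hne (hxu T (hIG hT) S (hIG hS)
          ((hG S (hIG hS)).convex (hxT S (hIG hS)) hpS h hxT'))
      · exact hne.symm (hxu S (hIG hS) T (hIG hT)
          ((hG T (hIG hT)).convex (hxT T (hIG hT)) hpT h hxS))
    have hhigh : ∀ S ∈ I, ∀ T ∈ I, p ∈ S → p ∈ T → S ≠ T → p ≤ x S → p ≤ x T → False := by
      intro S hS T hT hpS hpT hne hxS hxT'
      have hcell : cell (x S) = cell (x T) :=
        (hI S hS _ (hxT S (hIG hS)) p hpS).trans (hI T hT p hpT _ (hxT T (hIG hT)))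
      rcases hX.total_cell hcell with h | h
      · exact hne.symm (hxu S (hIG hS) T (hIG hT)
          ((hG T (hIG hT)).convex hpT (hxT T (hIG hT)) hxS h))
      · exact hne (hxu T (hIG hT) S (hIG hS)
          ((hG S (hIG hS)).convex hpS (hxT S (hIG hS)) hxT' h))
    have hcomp : ∀ S ∈ I, p ∈ S → x S ≤ p ∨ p ≤ x S := fun S hS hpS =>
      hX.total_cell (hI S hS _ (hxT S (hIG hS)) p hpS)
    rcases hcomp T₁ h₁ hp₁ with h | h <;> rcases hcomp T₂ h₂ hp₂ with h' | h' <;>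
      rcases hcomp T₃ h₃ hp₃ with h'' | h''
    · exact hlow T₁ h₁ T₂ h₂ hp₁ hp₂ h12 h h'
    · exact hlow T₁ h₁ T₂ h₂ hp₁ hp₂ h12 h h'
    · exact hlow T₁ h₁ T₃ h₃ hp₁ hp₃ h13 h h''
    · exact hhigh T₂ h₂ T₃ h₃ hp₂ hp₃ h23 h' h''
    · exact hlow T₂ h₂ T₃ h₃ hp₂ hp₃ h23 h' h''
    · exact hhigh T₁ h₁ T₃ h₃ hp₁ hp₃ h13 h h''
    · exact hhigh T₁ h₁ T₂ h₂ hp₁ hp₂ h12 h h'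
    · exact hhigh T₁ h₁ T₂ h₂ hp₁ hp₂ h12 h h'
  have hIB : ∀ T ∈ G, T ∉ I → T ∈ B := fun T hT hTI => by
    by_contra hTB
    exact hTI (Finset.mem_filter.2 ⟨hT, fun h => hTB (Finset.mem_filter.2 ⟨hT, h⟩)⟩)
  have hBI : ∀ T ∈ B, T ∉ I := fun T hT hTI =>
    (Finset.mem_filter.1 hTI).2 (Finset.mem_filter.1 hT).2
  -- Disjoint palettes: below `mB` for `B`, the next `ℓ + 1` colors for `I`, and one last color for
  -- the discarded trees.
  let c : Set X → ℕ := fun T =>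
    if T ∈ I then mB + cI T else if T ∈ B then cB T else mB + (ℓ + 1)
  have hcI' : ∀ T ∈ I, c T = mB + cI T := fun T hT => if_pos hT
  have hcB' : ∀ T ∈ B, c T = cB T := fun T hT => by
    simp only [c, if_neg (hBI T hT), if_pos hT]
  have hcN : ∀ T, T ∉ G → c T = mB + (ℓ + 1) := fun T hT => by
    have h1 : T ∉ I := fun h => hT (hIG h)
    have h2 : T ∉ B := fun h => hT (hBG h)
    simp only [c, if_neg h1, if_neg h2]
  refine ⟨mB + (ℓ + 1) + 1, c, ?_, fun T hT => ?_, fun p T hT hp => ?_⟩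
  · push_cast at hmB ⊢
    linarith
  · by_cases hTI : T ∈ I
    · rw [hcI' T hTI]
      have := (cI T).2
      omega
    · by_cases hTG : T ∈ G
      · rw [hcB' T (hIB T hTG hTI)]
        have := hcBlt T (hIB T hTG hTI)
        omega
      · rw [hcN T hTG]
        omega
  · obtain ⟨S, hS, hpS⟩ := hcov T hT p hp
    by_cases hex : ∃ S ∈ I, p ∈ S
    · obtain ⟨S, hS, hpS⟩ := hex
      refine ⟨S, hGA (hIG hS), hpS, fun S' hS' hpS' hne => ?_⟩
      rw [hcI' S hS]
      have := (cI S).2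
      by_cases hSI' : S' ∈ I
      · rw [hcI' S' hSI']
        obtain ⟨R, hR, R', hR', hpR, hpR', hRR'⟩ := hcI p S' hSI' S hS hne hpS' hpS
        have hRR'' : R ≠ R' := fun h => hRR' (h ▸ rfl)
        -- By the depth bound the bichromatic pair at `p` must be `S` and `S'` themselves.
        have h1 : R = S ∨ R = S' := by
          by_contra! h
          exact hdepth p R hR S hS S' hSI' hpR hpS hpS' h.1 h.2 hne.symm
        have h2 : R' = S ∨ R' = S' := by
          by_contra! h
          exact hdepth p R' hR' S hS S' hSI' hpR' hpS hpS' h.1 h.2 hne.symm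
        intro h
        have h3 : cI S' = cI S := Fin.ext (by omega)
        refine hRR' ((h1.elim (fun h => ?_) fun h => ?_ : cI R = cI S).trans
          (h2.elim (fun h => ?_) fun h => ?_ : cI R' = cI S).symm)
        · rw [h]
        · rw [h, h3]
        · rw [h]
        · rw [h, h3]
      · by_cases hSG' : S' ∈ G
        · rw [hcB' S' (hIB S' hSG' hSI')]
          have := hcBlt S' (hIB S' hSG' hSI')
          omega
        · rw [hcN S' hSG']
          omega
    · push Not at hex
      have hSB : S ∈ B := hIB S hS fun h => hex S h hpS
      obtain ⟨R, hR, hpR, hRu⟩ := hcB p S hSB hpS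
      refine ⟨R, hGA (hBG hR), hpR, fun S' hS' hpS' hne => ?_⟩
      rw [hcB' R hR]
      have := hcBlt R hR
      by_cases hSG' : S' ∈ G
      · have hSB' := hIB S' hSG' fun h => hex S' h hpS'
        rw [hcB' S' hSB']
        exact hRu S' hSB' hpS' hne
      · rw [hcN S' hSG']
        omega

end CellOrder

/-! ### Topology: connected sets are subtrees, maximal points are leaves -/

/-- A cell order compatible with a topology, as on a rooted topological tree. -/
structure IsTreeOrder {X V : Type*} [TopologicalSpace X] [PartialOrder X] (cell : X → V) : Prop
    extends IsCellOrder cell where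
  isClosed_Ici : ∀ x : X, IsClosed (Set.Ici x)
  isClosed_Iic : ∀ x : X, IsClosed (Set.Iic x)
  isClosed_insert_compl_Ici : ∀ x : X, IsClosed (insert x (Set.Ici x)ᶜ)
  exists_isPreconnected : ∀ x y : X, x ≤ y → ∃ C ⊆ Set.Icc x y, x ∈ C ∧ y ∈ C ∧ IsPreconnected C
  exists_bot : ∃ r : X, ∀ x, r ≤ x

section TreeOrder

variable {X V : Type*} [TopologicalSpace X] [PartialOrder X] {cell : X → V}

/-- The closed sets `Ici z` and its complement with `z` added cover the space and meet only in `z`,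
so a connected set meeting both contains `z`. -/
theorem IsTreeOrder.isSubtree (hX : IsTreeOrder cell) {T : Set X} (hT : IsPreconnected T) :
    IsSubtree T := by
  intro x hx y hy z hzy hzx
  obtain ⟨w, hwT, hw, hw'⟩ := isPreconnected_closed_iff.1 hT _ _ (hX.isClosed_Ici z)
    (hX.isClosed_insert_compl_Ici z)
    (fun w _ => (em (z ≤ w)).imp id fun h => Or.inr h) ⟨y, hy, hzy⟩ ⟨x, hx, Or.inr hzx⟩
  rcases hw' with rfl | hw'
  · exact hwT
  · exact (hw' hw).elim

theorem IsTreeOrder.exists_maximal [CompactSpace X] (hX : IsTreeOrder cell) {K : Set X}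
    (hK : IsClosed K) {x : X} (hx : x ∈ K) : ∃ q, x ≤ q ∧ Maximal (· ∈ K) q := by
  refine zorn_le_nonempty₀ K (fun c hcK hc y hy => ?_) x hx
  have : Nonempty c := ⟨⟨y, hy⟩⟩
  obtain ⟨u, hu⟩ := IsCompact.nonempty_iInter_of_directed_nonempty_isCompact_isClosed
    (fun z : c => Set.Ici z.1 ∩ K)
    (fun a b => (hc.total a.2 b.2).elim
      (fun h => ⟨b, fun w hw => ⟨h.trans hw.1, hw.2⟩, subset_rfl⟩)
      (fun h => ⟨a, subset_rfl, fun w hw => ⟨h.trans hw.1, hw.2⟩⟩))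
    (fun z => ⟨z, le_rfl, hcK z.2⟩)
    (fun z => ((hX.isClosed_Ici z.1).inter hK).isCompact)
    (fun z => (hX.isClosed_Ici z.1).inter hK)
  have hu := Set.mem_iInter.1 hu
  exact ⟨u, (hu ⟨y, hy⟩).2, fun z hz => (hu ⟨z, hz⟩).1⟩

/-- Two points of a closed subtree have a common lower bound in it. -/
theorem IsTreeOrder.exists_meet [CompactSpace X] [T1Space X] (hX : IsTreeOrder cell) {T : Set X}
    (hT : IsClosed T) (hsub : IsSubtree T) {x y : X} (hx : x ∈ T) (hy : y ∈ T) :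
    ∃ m ∈ T, m ≤ x ∧ m ≤ y := by
  obtain ⟨r, hr⟩ := hX.exists_bot
  obtain ⟨m, -, ⟨hmx, hmy⟩, hmax⟩ := hX.exists_maximal
    ((hX.isClosed_Iic x).inter (hX.isClosed_Iic y)) (x := r) ⟨hr x, hr y⟩
  refine ⟨m, ?_, hmx, hmy⟩
  by_contra hmT
  -- Points of `(m, x]` are not below `y` since `m` is a maximal common lower bound. A connected set
  -- from `m` to `x` within `{m} ∪ T` then forces `m ∈ T`, as both sets are closed.
  have hIoc : Set.Ioc m x ⊆ T := fun z hz => hsub y hy x hx z hz.2 fun hzy =>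
    hz.1.not_ge (hmax ⟨hz.2, hzy⟩ hz.1.le)
  obtain ⟨C, hC, hmC, hxC, hCp⟩ := hX.exists_isPreconnected m x hmx
  obtain ⟨w, -, hw, hw'⟩ := isPreconnected_closed_iff.1 hCp _ _ (isClosed_singleton (x := m)) hT
    (fun w hw => (eq_or_lt_of_le (hC hw).1).imp (fun h => h.symm) fun h => hIoc ⟨h, (hC hw).2⟩)
    ⟨m, hmC, rfl⟩ ⟨x, hxC, hx⟩
  exact hmT (Set.mem_singleton_iff.1 hw ▸ hw')

/-- Two points are joined through a common lower bound; these paths stay below points other than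
`q`, and a maximal `q` lies below no other point of `T`. -/
theorem IsTreeOrder.isPreconnected_diff_of_maximal [CompactSpace X] [T1Space X]
    (hX : IsTreeOrder cell) {T : Set X} (hT : IsClosed T) (hsub : IsSubtree T) {q : X}
    (hq : Maximal (· ∈ T) q) : IsPreconnected (T \ {q}) := by
  have hne : ∀ {x z}, x ∈ T → x ≠ q → z ≤ x → z ≠ q := fun hx hxq hzx h =>
    hxq (le_antisymm (hq.2 hx (h ▸ hzx)) (h ▸ hzx))
  refine isPreconnected_of_forall_pair fun x hx y hy => ?_
  obtain ⟨m, hm, hmx, hmy⟩ := hX.exists_meet hT hsub hx.1 hy.1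
  obtain ⟨C, hC, hmC, hxC, hCp⟩ := hX.exists_isPreconnected m x hmx
  obtain ⟨D, hD, hmD, hyD, hDp⟩ := hX.exists_isPreconnected m y hmy
  refine ⟨C ∪ D, Set.union_subset (fun z hz => ?_) (fun z hz => ?_), Or.inl hxC, Or.inr hyD,
    hCp.union m hmC hmD hDp⟩
  · exact ⟨hsub.convex hm hx.1 (hC hz).1 (hC hz).2, hne hx.1 hx.2 (hC hz).2⟩
  · exact ⟨hsub.convex hm hy.1 (hD hz).1 (hD hz).2, hne hy.1 hy.2 (hD hz).2⟩

theorem IsTreeOrder.exists_mem_treeLeaves [CompactSpace X] [T1Space X] (hX : IsTreeOrder cell)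
    {T : Set X} (hT : IsPreconnected T) {p : X} (hp : p ∈ T) : ∃ q ∈ treeLeaves T, p ≤ q := by
  obtain ⟨q, hpq, hq⟩ := hX.exists_maximal isClosed_closure (subset_closure hp)
  exact ⟨q, ⟨hq.1, hX.isPreconnected_diff_of_maximal isClosed_closure
    (hX.isSubtree hT.closure) hq⟩, hpq⟩

theorem IsTreeOrder.exists_finset_dominating [CompactSpace X] [T1Space X] (hX : IsTreeOrder cell)
    {T : Set X} (hT : IsPreconnected T) {ℓ : ℕ} (hℓ : (treeLeaves T).encard ≤ ℓ) :
    ∃ Q : Finset X, Q.card ≤ ℓ ∧ ∀ p ∈ T, ∃ q ∈ Q, p ≤ q := by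
  have hfin : (treeLeaves T).Finite := Set.finite_of_encard_le_coe hℓ
  refine ⟨hfin.toFinset, ?_, fun p hp => ?_⟩
  · rw [hfin.encard_eq_coe_toFinset_card] at hℓ
    exact_mod_cast hℓ
  · obtain ⟨q, hq, hpq⟩ := hX.exists_mem_treeLeaves hT hp
    exact ⟨q, by simpa using hq, hpq⟩

end TreeOrder

/-! ### Rooted trees of arcs and their order -/

/-- A rooted finite tree of arcs: the arc of `v` leads from the upper end of the arc of the parent
of `v` to the point of `v`; the arc of the root is constant. -/
structure RootedArcs (X V : Type*) [TopologicalSpace X] where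
  root : V
  parent : V → V
  depth : V → ℕ
  arc : V → unitInterval → X
  parent_root : parent root = root
  depth_eq : ∀ v, v ≠ root → depth v = depth (parent v) + 1
  arc_continuous : ∀ v, Continuous (arc v)
  arc_zero : ∀ v, arc v 0 = arc (parent v) 1
  arc_injective : ∀ v, v ≠ root → Function.Injective (arc v)
  arc_root : ∀ s t, arc root s = arc root t
  arc_cover : ∀ x, ∃ v t, t ≠ 0 ∧ arc v t = x
  eq_of_arc_eq : ∀ v w s t, s ≠ 0 → t ≠ 0 → arc v s = arc w t → v = w

namespace RootedArcs

variable {X V : Type*} [TopologicalSpace X] (R : RootedArcs X V)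

/-- `u` is an ancestor of `v`, or equal to it. -/
def Anc (u v : V) : Prop := ∃ n, R.parent^[n] v = u

variable {R}

theorem Anc.refl (v : V) : R.Anc v v := ⟨0, rfl⟩

theorem Anc.trans {u v w : V} : R.Anc u v → R.Anc v w → R.Anc u w := by
  rintro ⟨n, rfl⟩ ⟨m, rfl⟩
  exact ⟨n + m, Function.iterate_add_apply _ _ _ _⟩

theorem anc_parent (v : V) : R.Anc (R.parent v) v := ⟨1, rfl⟩

theorem Anc.total {u v w : V} : R.Anc u w → R.Anc v w → R.Anc u v ∨ R.Anc v u := by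
  rintro ⟨n, rfl⟩ ⟨m, rfl⟩
  rcases le_total n m with h | h
  · exact Or.inr ⟨m - n, by rw [← Function.iterate_add_apply, Nat.sub_add_cancel h]⟩
  · exact Or.inl ⟨n - m, by rw [← Function.iterate_add_apply, Nat.sub_add_cancel h]⟩

theorem iterate_parent_root (n : ℕ) : R.parent^[n] R.root = R.root :=
  Function.iterate_fixed R.parent_root n

theorem Anc.eq_or {u v : V} : R.Anc u v → u = v ∨ v ≠ R.root ∧ R.Anc u (R.parent v) := by
  rintro ⟨n, rfl⟩
  by_cases hv : v = R.root
  · subst hv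
    exact Or.inl (iterate_parent_root n)
  · cases n with
    | zero => exact Or.inl rfl
    | succ n => exact Or.inr ⟨hv, n, rfl⟩

theorem depth_parent_le (v : V) : R.depth (R.parent v) ≤ R.depth v := by
  by_cases hv : v = R.root
  · rw [hv, R.parent_root]
  · rw [R.depth_eq v hv]
    omega

theorem Anc.depth_le {u v : V} : R.Anc u v → R.depth u ≤ R.depth v := by
  rintro ⟨n, rfl⟩
  induction n with
  | zero => exact le_rfl
  | succ n ih =>
    rw [Function.iterate_succ_apply']
    exact (depth_parent_le _).trans ih

theorem Anc.depth_lt {u v : V} (h : R.Anc u v) (hne : u ≠ v) : R.depth u < R.depth v := by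
  obtain ⟨hv, h⟩ := h.eq_or.resolve_left hne
  have := h.depth_le
  have := R.depth_eq v hv
  omega

theorem anc_root (v : V) : R.Anc R.root v := by
  induction h : R.depth v using Nat.strong_induction_on generalizing v with
  | _ n ih =>
  by_cases hv : v = R.root
  · exact hv ▸ Anc.refl _
  · have := R.depth_eq v hv
    exact (ih _ (by omega) _ rfl).trans (anc_parent v)

variable (R)

/-- The vertex whose half-open arc contains `x`. -/
noncomputable def cell (x : X) : V := (R.arc_cover x).choose

/-- The parameter of `x` on the arc of its cell. -/
noncomputable def height (x : X) : unitInterval := (R.arc_cover x).choose_spec.choose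

variable {R}

theorem height_ne_zero (x : X) : R.height x ≠ 0 := (R.arc_cover x).choose_spec.choose_spec.1

theorem arc_cell_height (x : X) : R.arc (R.cell x) (R.height x) = x :=
  (R.arc_cover x).choose_spec.choose_spec.2

theorem cell_arc {v : V} {t : unitInterval} (ht : t ≠ 0) : R.cell (R.arc v t) = v :=
  R.eq_of_arc_eq _ _ _ _ (height_ne_zero _) ht (arc_cell_height _)

theorem height_arc {v : V} (hv : v ≠ R.root) {t : unitInterval} (ht : t ≠ 0) :
    R.height (R.arc v t) = t := by
  have h := arc_cell_height (R := R) (R.arc v t)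
  rw [cell_arc ht] at h
  exact R.arc_injective v hv h

theorem cell_arc_zero (v : V) : R.cell (R.arc v 0) = R.parent v := by
  rw [R.arc_zero, cell_arc one_ne_zero]

variable (R)

/-- The order of a rooted tree of arcs: `x ≤ y` if `x` lies on the path from the root to `y`. -/
@[reducible] noncomputable def order : PartialOrder X where
  le x y := (R.cell x = R.cell y ∧ R.height x ≤ R.height y) ∨
    (R.cell x ≠ R.cell y ∧ R.Anc (R.cell x) (R.cell y))
  le_refl x := Or.inl ⟨rfl, le_rfl⟩
  le_trans x y z := by
    rintro (⟨h1, h2⟩ | ⟨h1, h2⟩) (⟨h3, h4⟩ | ⟨h3, h4⟩)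
    · exact Or.inl ⟨h1.trans h3, h2.trans h4⟩
    · exact Or.inr ⟨h1 ▸ h3, h1 ▸ h4⟩
    · exact Or.inr ⟨h3 ▸ h1, h3 ▸ h2⟩
    · have h5 := (h2.depth_lt h1).trans (h4.depth_lt h3)
      exact Or.inr ⟨fun h => (h ▸ h5).false, h2.trans h4⟩
  le_antisymm x y := by
    rintro (⟨h1, h2⟩ | ⟨h1, h2⟩) (⟨h3, h4⟩ | ⟨h3, h4⟩)
    · rw [← arc_cell_height (R := R) x, ← arc_cell_height (R := R) y, h1, le_antisymm h2 h4]
    · exact (h3 h1.symm).elim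
    · exact (h1 h3.symm).elim
    · exact ((h2.depth_lt h1).trans (h4.depth_lt h3)).false.elim

theorem compactSpace (R : RootedArcs X V) [Finite V] : CompactSpace X := by
  refine ⟨?_⟩
  have : (Set.univ : Set X) = ⋃ v, Set.range (R.arc v) := by
    refine (Set.eq_univ_of_forall fun x => ?_).symm
    obtain ⟨v, t, -, h⟩ := R.arc_cover x
    exact Set.mem_iUnion.2 ⟨v, t, h⟩
  rw [this]
  exact isCompact_iUnion fun v => isCompact_range (R.arc_continuous v)

theorem isClosed_arc_union [T2Space X] [Finite V] (v : V) (I : Set unitInterval) (hI : IsClosed I)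
    (W : Set V) : IsClosed (R.arc v '' I ∪ ⋃ w ∈ W, Set.range (R.arc w)) :=
  ((hI.isCompact.image (R.arc_continuous v)).isClosed).union
    (W.toFinite.isClosed_biUnion fun w _ => (isCompact_range (R.arc_continuous w)).isClosed)

/-- Each set required to be closed is a closed piece of one arc together with finitely many whole
arcs. Whole arcs may be used although cells are half-open, because the start of an arc is the end of
the parent arc. -/
theorem isTreeOrder [T2Space X] [Finite V] :
    @IsTreeOrder X V _ R.order R.cell := by
  let := R.order
  have le_def : ∀ {x y : X}, x ≤ y ↔ (R.cell x = R.cell y ∧ R.height x ≤ R.height y) ∨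
    (R.cell x ≠ R.cell y ∧ R.Anc (R.cell x) (R.cell y)) := Iff.rfl
  have le_anc : ∀ {x y : X}, x ≤ y → R.Anc (R.cell x) (R.cell y) := by
    rintro x y (h | h)
    · exact h.1 ▸ Anc.refl _
    · exact h.2
  have arc_le_arc : ∀ {v : V} {s t : unitInterval}, s ≠ 0 → s ≤ t → R.arc v s ≤ R.arc v t := by
    intro v s t hs hst
    have ht : t ≠ 0 := fun h => hs (le_antisymm (h ▸ hst) unitInterval.nonneg')
    by_cases hv : v = R.root
    · rw [hv, R.arc_root s t]
    · exact Or.inl ⟨by rw [cell_arc hs, cell_arc ht], by rwa [height_arc hv hs, height_arc hv ht]⟩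
  have le_arc : ∀ {x : X} {t : unitInterval}, R.height x ≤ t → x ≤ R.arc (R.cell x) t := by
    intro x t ht
    have := arc_le_arc (v := R.cell x) (height_ne_zero x) ht
    rwa [arc_cell_height] at this
  have le_node : ∀ {x : X} {v : V}, R.Anc (R.cell x) v → x ≤ R.arc v 1 := by
    intro x v h
    by_cases hv : R.cell x = v
    · rw [← hv]
      exact le_arc unitInterval.le_one'
    · exact Or.inr ⟨by rwa [cell_arc one_ne_zero], by rwa [cell_arc one_ne_zero]⟩
  have le_arc_of_anc : ∀ {x : X} {w : V} (s : unitInterval), R.Anc (R.cell x) w → R.cell x ≠ w →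
      x ≤ R.arc w s := by
    intro x w s h hne
    by_cases hs : s = 0
    · rw [hs, R.arc_zero]
      exact le_node (h.eq_or.resolve_left hne).2
    · exact Or.inr ⟨by rwa [cell_arc hs], by rwa [cell_arc hs]⟩
  have arc_le_of_anc : ∀ {y : X} {v : V} (s : unitInterval), R.Anc v (R.cell y) → v ≠ R.cell y →
      R.arc v s ≤ y := by
    intro y v s h hne
    by_cases hs : s = 0
    · refine Or.inr ?_
      rw [hs, cell_arc_zero]
      refine ⟨fun h' => ?_, (anc_parent v).trans h⟩
      have h1 := h.depth_lt hne
      have h2 := depth_parent_le (R := R) v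
      rw [h'] at h2
      omega
    · exact Or.inr ⟨by rwa [cell_arc hs], by rwa [cell_arc hs]⟩
  have arc_le : ∀ {y : X} {s : unitInterval}, s ≤ R.height y → R.arc (R.cell y) s ≤ y := by
    intro y s hs
    by_cases hs0 : s = 0
    · by_cases hy : R.cell y = R.root
      · have : R.arc (R.cell y) s = y := by
          conv_rhs => rw [← arc_cell_height (R := R) y]
          rw [hy]
          exact R.arc_root _ _
        exact this.le
      · rw [hs0, R.arc_zero]
        refine arc_le_of_anc 1 (anc_parent _) fun h => ?_
        have := R.depth_eq _ hy
        rw [h] at this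
        omega
    · have := arc_le_arc (v := R.cell y) hs0 hs
      rwa [arc_cell_height] at this
  have hIci : ∀ x, Set.Ici x = R.arc (R.cell x) '' Set.Ici (R.height x) ∪
      ⋃ w ∈ {w | R.cell x ≠ w ∧ R.Anc (R.cell x) w}, Set.range (R.arc w) := by
    intro x
    ext z
    simp only [Set.mem_union, Set.mem_image, Set.mem_iUnion, Set.mem_range, Set.mem_Ici,
      Set.mem_ofPred_eq, exists_prop]
    constructor
    · rintro (⟨h1, h2⟩ | h)
      · exact Or.inl ⟨_, h2, by rw [h1, arc_cell_height]⟩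
      · exact Or.inr ⟨_, h, _, arc_cell_height z⟩
    · rintro (⟨t, ht, rfl⟩ | ⟨w, ⟨hne, hw⟩, s, rfl⟩)
      · exact le_arc ht
      · exact le_arc_of_anc s hw hne
  have hIci' : ∀ x, insert x (Set.Ici x)ᶜ = R.arc (R.cell x) '' Set.Iic (R.height x) ∪
      ⋃ w ∈ {w | ¬ R.Anc (R.cell x) w}, Set.range (R.arc w) := by
    intro x
    ext z
    simp only [Set.mem_union, Set.mem_image, Set.mem_iUnion, Set.mem_range, Set.mem_insert_iff,
      Set.mem_compl_iff, Set.mem_Ici, Set.mem_Iic, Set.mem_ofPred_eq, exists_prop]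
    constructor
    · rintro (rfl | h)
      · exact Or.inl ⟨_, le_rfl, arc_cell_height z⟩
      · by_cases hz : R.cell x = R.cell z
        · exact Or.inl ⟨R.height z, le_of_not_ge fun h' => h (Or.inl ⟨hz, h'⟩),
            by rw [hz, arc_cell_height]⟩
        · exact Or.inr ⟨_, fun h' => h (Or.inr ⟨hz, h'⟩), _, arc_cell_height z⟩
    · rintro (⟨s, hs, rfl⟩ | ⟨w, hw, s, rfl⟩)
      · exact or_iff_not_imp_right.2 fun h => le_antisymm (arc_le hs) (not_not.1 h)
      · refine Or.inr fun h => hw ?_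
        have h := le_anc h
        by_cases hs : s = 0
        · rw [hs, cell_arc_zero] at h
          exact h.trans (anc_parent w)
        · rwa [cell_arc hs] at h
  have hIic : ∀ y, Set.Iic y = R.arc (R.cell y) '' Set.Iic (R.height y) ∪
      ⋃ w ∈ {w | w ≠ R.cell y ∧ R.Anc w (R.cell y)}, Set.range (R.arc w) := by
    intro y
    ext z
    simp only [Set.mem_union, Set.mem_image, Set.mem_iUnion, Set.mem_range, Set.mem_Iic,
      Set.mem_ofPred_eq, exists_prop]
    constructor
    · rintro (⟨h1, h2⟩ | h)
      · exact Or.inl ⟨_, h2, by rw [← h1, arc_cell_height]⟩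
      · exact Or.inr ⟨_, h, _, arc_cell_height z⟩
    · rintro (⟨t, ht, rfl⟩ | ⟨w, ⟨hne, hw⟩, s, rfl⟩)
      · exact arc_le ht
      · exact arc_le_of_anc s hw hne
  have tot : ∀ {x y : X}, R.cell x = R.cell y → x ≤ y ∨ y ≤ x := fun {x y} h =>
    (le_total (R.height x) (R.height y)).imp (fun h' => Or.inl ⟨h, h'⟩)
      (fun h' => Or.inl ⟨h.symm, h'⟩)
  have hpre : ∀ (n : ℕ) (x y : X), R.depth (R.cell y) = n → x ≤ y →
      ∃ C ⊆ Set.Icc x y, x ∈ C ∧ y ∈ C ∧ IsPreconnected C := by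
    intro n
    induction n using Nat.strong_induction_on with
    | _ n ih =>
    rintro x y hn (⟨h1, h2⟩ | ⟨h1, h2⟩)
    · refine ⟨R.arc (R.cell y) '' Set.Icc (R.height x) (R.height y), ?_,
        ⟨_, ⟨le_rfl, h2⟩, by rw [← h1, arc_cell_height]⟩, ⟨_, ⟨h2, le_rfl⟩, arc_cell_height y⟩,
        isPreconnected_Icc.image _ (R.arc_continuous _).continuousOn⟩
      rintro _ ⟨s, hs, rfl⟩
      exact ⟨h1 ▸ le_arc hs.1, arc_le hs.2⟩
    · obtain ⟨hy, -⟩ := h2.eq_or.resolve_left h1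
      have hd := R.depth_eq _ hy
      obtain ⟨C, hC, hxC, hyC, hCp⟩ := ih (R.depth (R.cell (R.arc (R.cell y) 0)))
        (by rw [cell_arc_zero]; omega) x (R.arc (R.cell y) 0) rfl (le_arc_of_anc 0 h2 h1)
      refine ⟨C ∪ R.arc (R.cell y) '' Set.Iic (R.height y), Set.union_subset (fun z hz => ?_) ?_,
        Or.inl hxC, Or.inr ⟨_, Set.self_mem_Iic, arc_cell_height y⟩, hCp.union _ hyC
          ⟨0, unitInterval.nonneg', rfl⟩
          (isPreconnected_Iic.image _ (R.arc_continuous _).continuousOn)⟩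
      · exact ⟨(hC hz).1, (hC hz).2.trans (arc_le unitInterval.nonneg')⟩
      · rintro _ ⟨s, hs, rfl⟩
        exact ⟨le_arc_of_anc s h2 h1, arc_le hs⟩
  refine { total_below := ?_, total_cell := tot, le_of_cell_ne := ?_, isClosed_Ici := ?_,
           isClosed_Iic := ?_, isClosed_insert_compl_Ici := ?_,
           exists_isPreconnected := fun x y h => hpre _ x y rfl h,
           exists_bot := ⟨R.arc R.root 1, fun x => ?_⟩ }
  · intro x y z hx hy
    by_cases h : R.cell x = R.cell y
    · exact tot h
    · exact ((le_anc hx).total (le_anc hy)).imp (fun h' => Or.inr ⟨h, h'⟩)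
        (fun h' => Or.inr ⟨fun h'' => h h''.symm, h'⟩)
  · intro x y z hxy hne hz
    exact Or.inr ⟨fun h => hne (h.symm.trans hz), hz ▸ le_anc hxy⟩
  · intro x
    rw [hIci]
    exact R.isClosed_arc_union _ _ isClosed_Ici _
  · intro x
    rw [hIic]
    exact R.isClosed_arc_union _ _ isClosed_Iic _
  · intro x
    rw [hIci']
    exact R.isClosed_arc_union _ _ isClosed_Iic _
  · by_cases hx : R.cell x = R.root
    · have : R.arc R.root 1 = x := by
        conv_rhs => rw [← arc_cell_height (R := R) x]
        rw [hx]
        exact R.arc_root _ _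
      exact this.le
    · exact arc_le_of_anc 1 (anc_root _) fun h => hx h.symm

end RootedArcs

/-! ### From tree spaces to rooted arcs -/

theorem SimpleGraph.IsTree.exists_parent {V : Type*} [Finite V] {G : SimpleGraph V}
    (hG : G.IsTree) (r : V) :
    ∃ p : V → V, p r = r ∧ (∀ v, v ≠ r → G.Adj v (p v) ∧ G.dist r v = G.dist r (p v) + 1) ∧
      (∀ v w, v ≠ r → w ≠ r → s(v, p v) = s(w, p w) → v = w) ∧
      ∀ e ∈ G.edgeSet, ∃ v, v ≠ r ∧ e = s(v, p v) := by
  classical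
  have := Fintype.ofFinite V
  have hex : ∀ v, ∃ w, (v = r → w = r) ∧
      (v ≠ r → G.Adj v w ∧ G.dist r v = G.dist r w + 1) := by
    intro v
    by_cases hv : v = r
    · exact ⟨r, fun _ => rfl, fun h => (h hv).elim⟩
    · obtain ⟨W, hW⟩ := hG.connected.exists_walk_length_eq_dist v r
      cases W with
      | nil => exact (hv rfl).elim
      | @cons _ w _ h W =>
        refine ⟨w, fun h => (hv h).elim, fun _ => ⟨h, ?_⟩⟩
        have h1 := SimpleGraph.dist_le W
        have h2 := hG.dist_eq_dist_add_one_of_adj r h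
        rw [SimpleGraph.Walk.length_cons] at hW
        rw [SimpleGraph.dist_comm, SimpleGraph.dist_comm (u := r) (v := w)] at h2 ⊢
        omega
  choose p hp1 hp2 using hex
  have hinj : ∀ v w, v ≠ r → w ≠ r → s(v, p v) = s(w, p w) → v = w := by
    intro v w hv hw h
    rcases Sym2.eq_iff.1 h with h | h
    · exact h.1
    · have h1 := (hp2 v hv).2
      have h2 := (hp2 w hw).2
      rw [h.2] at h1
      rw [← h.1] at h2
      omega
  refine ⟨p, hp1 r rfl, hp2, hinj, ?_⟩
  -- Parent edges are distinct, and a tree has exactly as many edges as non-root vertices, so every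
  -- edge is a parent edge.
  let f : {v // v ≠ r} → G.edgeSet := fun v => ⟨s(v.1, p v.1), (hp2 v.1 v.2).1⟩
  have hf : Function.Bijective f := by
    refine (Fintype.bijective_iff_injective_and_card f).2 ⟨fun v w h =>
      Subtype.ext (hinj _ _ v.2 w.2 (Subtype.mk.inj h)), ?_⟩
    have h1 := hG.card_edgeFinset
    rw [SimpleGraph.edgeFinset_card] at h1
    have h2 : Fintype.card {v // v ≠ r} = Fintype.card V - 1 := by
      rw [Fintype.card_subtype_compl, Fintype.card_subtype_eq]
    omega
  intro e he
  obtain ⟨v, hv⟩ := hf.2 ⟨e, he⟩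
  exact ⟨v.1, v.2, (congrArg Subtype.val hv).symm⟩

namespace TreeSpace

variable {X : Type*} [TopologicalSpace X]

/-- Degree plus 2 for each leaf is at least 3 at every node; the degrees sum to 2(|V| - 1). -/
theorem card_V_add_two_le (𝒯 : TreeSpace X) : Nat.card 𝒯.V + 2 ≤ 2 * 𝒯.numLeaves := by
  classical
  have := 𝒯.finite_V
  have := Fintype.ofFinite 𝒯.V
  have hdeg : ∀ v, (𝒯.graph.neighborSet v).ncard = 𝒯.graph.degree v := fun v => by
    rw [Set.ncard_eq_toFinset_card', SimpleGraph.degree, SimpleGraph.neighborFinset]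
  have h1 := 𝒯.isTree.card_edgeFinset
  have h2 := 𝒯.graph.sum_degrees_eq_twice_card_edges
  have h3 : ∑ _v : 𝒯.V, 3 ≤
      ∑ v, (𝒯.graph.degree v + 2 * if (𝒯.graph.neighborSet v).ncard = 1 then 1 else 0) := by
    refine Finset.sum_le_sum fun v _ => ?_
    rcases 𝒯.degree_eq_one_or v with h | h
    · rw [if_pos h, ← hdeg, h]
    · rw [← hdeg]
      omega
  have h4 : (∑ v : 𝒯.V, if (𝒯.graph.neighborSet v).ncard = 1 then 1 else 0) = 𝒯.numLeaves := by
    rw [Finset.sum_boole, TreeSpace.numLeaves, Set.ncard_eq_toFinset_card', Set.toFinset_ofPred]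
    rfl
  rw [Finset.sum_add_distrib, ← Finset.mul_sum, h4, h2, Finset.sum_const, Finset.card_univ,
    smul_eq_mul] at h3
  rw [Nat.card_eq_fintype_card]
  omega

theorem exists_oriented_arc (𝒯 : TreeSpace X) {u v : 𝒯.V} (h : s(u, v) ∈ 𝒯.graph.edgeSet) :
    ∃ a : unitInterval → X, Continuous a ∧ Function.Injective a ∧ a 0 = 𝒯.node v ∧
      a 1 = 𝒯.node u ∧ Set.range a = Set.range (𝒯.arc ⟨s(u, v), h⟩) := by
  set e : 𝒯.graph.edgeSet := ⟨s(u, v), h⟩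
  have hends := 𝒯.arc_ends e
  rw [show Sym2.map 𝒯.node (e : Sym2 𝒯.V) = s(𝒯.node u, 𝒯.node v) from rfl] at hends
  rcases Sym2.eq_iff.1 hends with h | h
  · exact ⟨𝒯.arc e ∘ unitInterval.symm, (𝒯.arc_continuous e).comp unitInterval.continuous_symm,
      (𝒯.arc_injective e).comp unitInterval.symm_involutive.injective, by simp [h.2],
      by simp [h.1], unitInterval.symm_involutive.surjective.range_comp _⟩
  · exact ⟨𝒯.arc e, 𝒯.arc_continuous e, 𝒯.arc_injective e, h.1, h.2, rfl⟩

theorem nonempty_rootedArcs (𝒯 : TreeSpace X) : Nonempty (RootedArcs X 𝒯.V) := by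
  have := 𝒯.finite_V
  obtain ⟨r⟩ := 𝒯.isTree.connected.nonempty
  obtain ⟨p, hpr, hp, hinj, hsurj⟩ := 𝒯.isTree.exists_parent r
  have hex : ∀ v, ∃ a : unitInterval → X, Continuous a ∧ a 0 = 𝒯.node (p v) ∧ a 1 = 𝒯.node v ∧
      (v = r → ∀ s, a s = 𝒯.node r) ∧ (v ≠ r → Function.Injective a ∧
        ∃ h : s(v, p v) ∈ 𝒯.graph.edgeSet, Set.range a = Set.range (𝒯.arc ⟨s(v, p v), h⟩)) := by
    intro v
    by_cases hv : v = r
    · subst hv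
      exact ⟨fun _ => 𝒯.node v, continuous_const, by rw [hpr], rfl, fun _ _ => rfl,
        fun h => (h rfl).elim⟩
    · obtain ⟨a, h1, h2, h3, h4, h5⟩ := 𝒯.exists_oriented_arc (hp v hv).1
      exact ⟨a, h1, h3, h4, fun h => (hv h).elim, fun _ => ⟨h2, (hp v hv).1, h5⟩⟩
  choose a hcont h0 h1 hroot hne using hex
  -- The only node on the half-open arc of `v` is `v`; this makes the cells disjoint.
  have hnode : ∀ v t w, t ≠ 0 → a v t = 𝒯.node w → v = w := by
    intro v t w ht h
    apply 𝒯.node_injective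
    by_cases hv : v = r
    · rw [← h, hroot v hv, hv]
    · obtain ⟨hi, he, hran⟩ := hne v hv
      have hends := 𝒯.arc_ends ⟨s(v, p v), he⟩
      obtain ⟨t', ht'⟩ : a v t ∈ Set.range (𝒯.arc ⟨s(v, p v), he⟩) := hran ▸ ⟨t, rfl⟩
      have hw : 𝒯.node w = 𝒯.node v ∨ 𝒯.node w = 𝒯.node (p v) := by
        have hmem : 𝒯.node w ∈ s(𝒯.arc ⟨s(v, p v), he⟩ 0, 𝒯.arc ⟨s(v, p v), he⟩ 1) := by
          rw [Sym2.mem_iff]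
          rcases 𝒯.arc_eq_node _ t' w (ht'.trans h) with h' | h' <;> subst h'
          · exact Or.inl (ht'.trans h).symm
          · exact Or.inr (ht'.trans h).symm
        rw [hends] at hmem
        simpa using hmem
      rcases hw with hw | hw
      · exact hw.symm
      · exact (ht (hi (h.trans (hw.trans (h0 v).symm)))).elim
  exact ⟨{
    root := r
    parent := p
    depth := 𝒯.graph.dist r
    arc := a
    parent_root := hpr
    depth_eq := fun v hv => (hp v hv).2
    arc_continuous := hcont
    arc_zero := fun v => by rw [h0, h1]
    arc_injective := fun v hv => (hne v hv).1
    arc_root := fun s t => by rw [hroot r rfl, hroot r rfl]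
    arc_cover := fun x => by
      obtain ⟨e, t, rfl⟩ := 𝒯.arc_cover x
      obtain ⟨v, hv, he⟩ := hsurj e.1 e.2
      obtain ⟨hi, he', hran⟩ := hne v hv
      have hee : e = ⟨s(v, p v), he'⟩ := Subtype.ext he
      obtain ⟨s, hs⟩ : 𝒯.arc e t ∈ Set.range (a v) := by rw [hran, hee]; exact ⟨t, rfl⟩
      by_cases hs0 : s = 0
      · exact ⟨p v, 1, one_ne_zero, by rw [h1, ← h0, ← hs, hs0]⟩
      · exact ⟨v, s, hs0, hs⟩
    eq_of_arc_eq := fun v w s t hs ht h => by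
      by_cases hv : v = r
      · rw [hroot v hv, ← hv] at h
        exact (hnode w t v ht h.symm).symm
      by_cases hw : w = r
      · rw [hroot w hw, ← hw] at h
        exact hnode v s w hs h
      obtain ⟨-, he, hran⟩ := hne v hv
      obtain ⟨-, he', hran'⟩ := hne w hw
      obtain ⟨s', hs'⟩ : a v s ∈ Set.range (𝒯.arc ⟨s(v, p v), he⟩) := hran ▸ ⟨s, rfl⟩
      obtain ⟨t', ht'⟩ : a w t ∈ Set.range (𝒯.arc ⟨s(w, p w), he'⟩) := hran' ▸ ⟨t, rfl⟩
      by_contra hvw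
      obtain ⟨u, hu⟩ := 𝒯.arc_disjoint ⟨s(v, p v), he⟩ ⟨s(w, p w), he'⟩ s' t'
        (fun h => hvw (hinj v w hv hw (Subtype.mk.inj h))) (by rw [hs', ht', h])
      exact hvw ((hnode v s u hs (by rw [← hs', hu])).trans
        (hnode w t u ht (by rw [← h, ← hs', hu])).symm) }⟩

end TreeSpace

/-! ### The two bounds -/

theorem NonMono.isNMColoring {X κ : Type*} {𝒜 : Finset (Set X)} {c : Set X → κ}
    (hc : NonMono 𝒜 c) : IsNMColoring 𝒜 fun T => c T.1 := by
  rintro p ⟨S, hS, T, hT, hne⟩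
  obtain ⟨S', hS', T', hT', hpS, hpT, h⟩ := hc p S.1 S.2 T.1 T.2
    (fun h => hne (Subtype.ext h)) hS hT
  exact ⟨⟨S', hS'⟩, hpS, ⟨T', hT'⟩, hpT, h⟩

theorem ConflictFree.isCFColoring {X : Type*} {𝒜 : Finset (Set X)} {c : Set X → ℕ} {m : ℕ}
    (hc : ConflictFree 𝒜 c) (hlt : ∀ T ∈ 𝒜, c T < m) :
    IsCFColoring 𝒜 fun T => (⟨c T.1, hlt T.1 T.2⟩ : Fin m) := by
  rintro p ⟨T, hT⟩
  obtain ⟨S, hS, hpS, h⟩ := hc p T.1 T.2 hT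
  exact ⟨⟨S, hS⟩, hpS, fun S' hpS' hne h' => h S'.1 S'.2 hpS' (fun h => hne (Subtype.ext h))
    (Fin.mk.inj h')⟩

theorem theorem1 :
    (∀ (k ℓ n : ℕ) (X : Type*) [TopologicalSpace X] [T2Space X] (𝒯 : TreeSpace X)
      (𝒜 : Finset (Set X)), IsTreeFamily 𝒯 k ℓ n 𝒜 →
        ∃ m : ℕ, (m : ℝ) ≤ min ((ℓ : ℝ) + 1) (2 * √(6 * (k : ℝ))) ∧
          ∃ c : {T // T ∈ 𝒜} → Fin m, IsNMColoring 𝒜 c) ∧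
    (∃ C : ℝ, ∀ (k ℓ n : ℕ) (X : Type*) [TopologicalSpace X] [T2Space X] (𝒯 : TreeSpace X)
      (𝒜 : Finset (Set X)), IsTreeFamily 𝒯 k ℓ n 𝒜 →
        ∃ m : ℕ, (m : ℝ) ≤ C * (ℓ : ℝ) * Real.log (k : ℝ) ∧
          ∃ c : {T // T ∈ 𝒜} → Fin m, IsCFColoring 𝒜 c) := by
  refine ⟨fun k ℓ n X _ _ 𝒯 𝒜 h => ?_, 12, fun k ℓ n X _ _ 𝒯 𝒜 h => ?_⟩
  · obtain ⟨R⟩ := 𝒯.nonempty_rootedArcs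
    have := 𝒯.finite_V
    have := R.compactSpace
    let := R.order
    have hR := R.isTreeOrder
    have hcard := 𝒯.card_V_add_two_le
    have hk := h.numLeaves_le
    have hsub : ∀ T ∈ 𝒜, IsSubtree T := fun T hT => hR.isSubtree (h.isConnected T hT).isPreconnected
    rcases le_total ((ℓ : ℝ) + 1) (2 * √(6 * (k : ℝ))) with hle | hle
    · obtain ⟨c, hc⟩ := hR.exists_nonMono 𝒜 hsub fun T hT =>
        hR.exists_finset_dominating (h.isConnected T hT).isPreconnected (h.leaves_le T hT)
      exact ⟨ℓ + 1, by rw [min_eq_left hle]; push_cast; exact le_rfl, _, hc.isNMColoring⟩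
    · have hsq : 2 * √(6 * (k : ℝ)) = √(24 * (k : ℝ)) := by
        rw [show (24 : ℝ) * k = 2 ^ 2 * (6 * k) by ring, Real.sqrt_mul (by norm_num) (6 * (k : ℝ)),
          Real.sqrt_sq (by norm_num)]
      set N := ⌊√(24 * (k : ℝ))⌋₊
      have hN1 : (N : ℝ) ≤ √(24 * (k : ℝ)) := Nat.floor_le (Real.sqrt_nonneg _)
      have hN2 : 24 * k < (N + 1) * (N + 1) := by
        have h1 : √(24 * (k : ℝ)) < N + 1 := Nat.lt_floor_add_one _
        have h2 := Real.mul_self_sqrt (show (0 : ℝ) ≤ 24 * k by positivity)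
        have h3 : (24 * k : ℝ) < (N + 1) * (N + 1) := by
          rw [← h2]
          exact mul_self_lt_mul_self (Real.sqrt_nonneg _) h1
        exact_mod_cast h3
      have hN3 : 3 ≤ N := by
        by_contra hlt
        have : (N + 1) * (N + 1) ≤ 3 * 3 := Nat.mul_le_mul (by omega) (by omega)
        omega
      -- `6|V| < 12k < (N + 1)² / 2 ≤ N(N + 1)`.
      obtain ⟨c, hc⟩ := hR.exists_nonMono_of_card 𝒜 hsub hN3 (by nlinarith)
      exact ⟨N, by rwa [min_eq_right hle, hsq], _, hc.isNMColoring⟩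
  · obtain ⟨R⟩ := 𝒯.nonempty_rootedArcs
    have := 𝒯.finite_V
    have := R.compactSpace
    let := R.order
    have hR := R.isTreeOrder
    have hcard := 𝒯.card_V_add_two_le
    have hk := h.numLeaves_le
    have hV : 0 < Nat.card 𝒯.V := by
      have := 𝒯.isTree.connected.nonempty
      exact Nat.card_pos
    -- Here `k ≥ 2`, because `1 + 2 ≤ |V| + 2 ≤ 2k`.
    have hlogk : Real.log 2 ≤ Real.log k :=
      Real.log_le_log (by norm_num) (by exact_mod_cast (by omega : 2 ≤ k))
    have hlog2 := Real.log_two_gt_d9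
    -- For empty `𝒜` possibly `ℓ = 0`, so no color may be used; otherwise a tree has a leaf and `ℓ ≥
    -- 1`.
    rcases 𝒜.eq_empty_or_nonempty with hA | ⟨T₀, hT₀⟩
    · refine ⟨0, by push_cast; have := hlog2.trans_le hlogk; positivity,
        fun T => absurd T.2 (by simp [hA]), fun p ⟨T, _⟩ => absurd T.2 (by simp [hA])⟩
    · have hdom : ∀ T ∈ 𝒜, ∃ Q : Finset X, Q.card ≤ ℓ ∧ ∀ p ∈ T, ∃ q ∈ Q, p ≤ q := fun T hT =>
        hR.exists_finset_dominating (h.isConnected T hT).isPreconnected (h.leaves_le T hT)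
      have hℓ : (1 : ℝ) ≤ ℓ := by
        obtain ⟨p, hp⟩ := (h.isConnected T₀ hT₀).nonempty
        obtain ⟨Q, hQ, hQ'⟩ := hdom T₀ hT₀
        obtain ⟨q, hq, -⟩ := hQ' p hp
        exact_mod_cast (Finset.card_pos.2 ⟨q, hq⟩).trans_le hQ
      obtain ⟨m, c, hm, hlt, hc⟩ := hR.exists_conflictFree 𝒜
        (fun T hT => hR.isSubtree (h.isConnected T hT).isPreconnected) hdom
      refine ⟨m, hm.trans ?_, _, hc.isCFColoring hlt⟩
      have h1 : Real.log (2 * Nat.card 𝒯.V : ℕ) ≤ 3 * Real.log k := by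
        have h2 : Real.log (2 * Nat.card 𝒯.V : ℕ) ≤ Real.log (2 ^ 2 * k) := by
          refine Real.log_le_log (by exact_mod_cast (by omega)) ?_
          exact_mod_cast (by omega : 2 * Nat.card 𝒯.V ≤ 2 ^ 2 * k)
        rw [Real.log_mul (by norm_num) (by norm_cast; omega), Real.log_pow] at h2
        push_cast at h2 ⊢
        linarith
      have h3 : ((ℓ : ℝ) + 1) * Real.log (2 * Nat.card 𝒯.V : ℕ) ≤ (2 * ℓ) * (3 * Real.log k) := by
        gcongr
        linarith
      -- The count is at most `6ℓ log k + ℓ + 3`, and `ℓ + 3 ≤ 4ℓ ≤ 6ℓ log k` since `6 log 2 > 4`;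
      -- hence the constant 12.
      nlinarith
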